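/- Let $\Gamma_1=\Gamma_2=1$, $\Gamma_3=\Gamma_4=m\in\mathbb R$. For $s=(s_{ij})_{1\le i,j\le 4}$ symmetric with $s_{ii}=0$ and $s_{ij}>0$ for $i\neq j$, and for $\lambda'\in\mathbb R$, put $S_{ij}=s_{ij}^{-1}+\lambda'$ for $i\ne j$ and $S_{ii}=0$. Let $\mathcal E_{m,\lambda'}$ be the system consisting of * the Albouy–Chenciner equations $\sum_{k=1}^4\Gamma_k\big[S_{ik}(s_{jk}-s_{ik}-s_{ij})+S_{jk}(s_{ik}-s_{jk}-s_{ij})\big]=0$ for $i<j$, * the unsymmetrized equations $\sum_{k=1}^4\Gamma_kS_{ik}(s_{jk}-s_{ik}-s_{ij})=0$ for $i\ne j$, * the vanishing of the Cayley–Menger determinant of $s$, * the Dziobek equations $S_{ij}S_{kl}=S_{ik}S_{jl}$ for all distinct $i,j,k,l$. A configuration of four distinct points $x_1,\dots,x_4\in\mathbb R^2$ is a kite with $i,j$ on the axis if $x_i$ and $x_j$ lie on a line of symmetry exchanging the other two points. It is a rhombus if, for some labelling, the points are the vertices of a quadrilateral with four equal sides. It is convex if no point lies in the convex hull of the other three,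 and concave if one point lies in the interior of the triangle formed by the other three. A strict kite solution of $\mathcal E_{m,\lambda'}$ is a positive solution $s$ with $s_{ij}=\|x_i-x_j\|^2$ for some kite $(x_1,\dots,x_4)$ that is not a rhombus. **Theorem.** 1. For each $m\in(-\infty,-2)\cup(-\tfrac12,0)\cup(0,\infty)$, the system $\mathcal E_{m,-1}$ has exactly four strict kite solutions. 2. If $m>0$, all these configurations are concave. 3. If $m\in(-\tfrac12,0)$, exactly two of them are convex with vortices $3,4$ on the axis of symmetry, and exactly two are concave with vortices $1,2$ on the axis. 4. If $m<-2$, exactly two of them are concave with vortices $3,4$ on the axis, and exactly two are convex with vortices $1,2$ on the axis. 5. For every other $m\neq0$ (that is, $m\in[-2,-\tfrac12]$) and every $\lambda'<0$, $\mathcal E_{m,\lambda'}$ has no strict kite solution. -/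

import Mathlib

/-!
Vortices 1, 2, 3, 4 are indexed by `0, 1, 2, 3 : Fin 4`. An array `s : Fin 4 → Fin 4 → ℝ` holds the
six squared mutual distances `s i j = r_{ij}²` (it is symmetric with zero diagonal).
-/

/-- Vortex strengths `Γ₁ = Γ₂ = 1`, `Γ₃ = Γ₄ = m`. -/
def vortexStrength (m : ℝ) : Fin 4 → ℝ := ![1, 1, m, m]

/-- `S_{ij} = 1 / r_{ij}² + λ'` for `i ≠ j`, and `S_{ii} = 0`. -/
noncomputable def coeffS (lam : ℝ) (s : Fin 4 → Fin 4 → ℝ) (i j : Fin 4) : ℝ :=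
  if i = j then 0 else (s i j)⁻¹ + lam

/-- Left-hand side `f_{ij}` of the Albouy-Chenciner equations. -/
noncomputable def albouyChenciner (m lam : ℝ) (s : Fin 4 → Fin 4 → ℝ) (i j : Fin 4) : ℝ :=
  ∑ k, vortexStrength m k *
    (coeffS lam s i k * (s j k - s i k - s i j) + coeffS lam s j k * (s i k - s j k - s i j))

/-- Left-hand side `g_{ij}` of the unsymmetrized Albouy-Chenciner equations. -/
noncomputable def unsymAlbouyChenciner (m lam : ℝ) (s : Fin 4 → Fin 4 → ℝ) (i j : Fin 4) : ℝ :=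
  ∑ k, vortexStrength m k * coeffS lam s i k * (s j k - s i k - s i j)

/-- The Cayley-Menger determinant of the array of squared distances. -/
noncomputable def cayleyMenger (s : Fin 4 → Fin 4 → ℝ) : ℝ :=
  Matrix.det !![0, 1, 1, 1, 1;
                1, 0, s 0 1, s 0 2, s 0 3;
                1, s 0 1, 0, s 1 2, s 1 3;
                1, s 0 2, s 1 2, 0, s 2 3;
                1, s 0 3, s 1 3, s 2 3, 0]

/-- Left-hand side `h_{ijkl}` of the Dziobek equations. -/
noncomputable def dziobek (lam : ℝ) (s : Fin 4 → Fin 4 → ℝ) (i j k l : Fin 4) : ℝ :=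
  ((s i j)⁻¹ + lam) * ((s k l)⁻¹ + lam) - ((s i k)⁻¹ + lam) * ((s j l)⁻¹ + lam)

/-- `s` is a real, positive solution of the complete system (Albouy-Chenciner, unsymmetrized
Albouy-Chenciner, Cayley-Menger and Dziobek equations) with parameters `m` and `λ' = lam`. -/
structure IsPositiveSolution (m lam : ℝ) (s : Fin 4 → Fin 4 → ℝ) : Prop where
  diag : ∀ i, s i i = 0
  symm : ∀ i j, s i j = s j i
  pos : ∀ i j, i ≠ j → 0 < s i j
  albouyChenciner_eq : ∀ i j, i < j → albouyChenciner m lam s i j = 0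
  unsym_eq : ∀ i j, i ≠ j → unsymAlbouyChenciner m lam s i j = 0
  cayleyMenger_eq : cayleyMenger s = 0
  dziobek_eq : ∀ i j k l : Fin 4, [i, j, k, l].Nodup → dziobek lam s i j k l = 0

/-- The planar configuration `x` has squared mutual distances `s`. -/
def Realizes (x : Fin 4 → EuclideanSpace ℝ (Fin 2)) (s : Fin 4 → Fin 4 → ℝ) : Prop :=
  ∀ i j, s i j = dist (x i) (x j) ^ 2

/-- A kite with vortices `i` and `j` on the axis of symmetry: the vortices are at distinct points,
and the line with respect to which the other two vortices `k` and `l` are mirror images of each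
other (the perpendicular bisector of `x k` and `x l`) contains `x i` and `x j`. -/
def IsKiteWithAxis (x : Fin 4 → EuclideanSpace ℝ (Fin 2)) (i j : Fin 4) : Prop :=
  Function.Injective x ∧ ∃ k l : Fin 4, [i, j, k, l].Nodup ∧
    x i ∈ AffineSubspace.perpBisector (x k) (x l) ∧ x j ∈ AffineSubspace.perpBisector (x k) (x l)

/-- A rhombus: distinct points such that, for some labelling with opposite pairs `{i, j}` and
`{k, l}`, the four sides are equal. -/
def IsRhombus (x : Fin 4 → EuclideanSpace ℝ (Fin 2)) : Prop :=
  Function.Injective x ∧ ∃ i j k l : Fin 4, [i, j, k, l].Nodup ∧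
    dist (x i) (x k) = dist (x k) (x j) ∧ dist (x k) (x j) = dist (x j) (x l) ∧
    dist (x j) (x l) = dist (x l) (x i)

/-- A convex configuration: no vortex lies in the convex hull of the other three. -/
def IsConvexConfig (x : Fin 4 → EuclideanSpace ℝ (Fin 2)) : Prop :=
  ConvexIndependent ℝ x

/-- A concave configuration: one vortex lies in the interior of the triangle formed by the other
three. -/
def IsConcaveConfig (x : Fin 4 → EuclideanSpace ℝ (Fin 2)) : Prop :=
  ∃ i, x i ∈ interior (convexHull ℝ (x '' {i}ᶜ))

/-- The positive solutions of the system that correspond to kites which are not rhombi. -/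
def kiteSolutions (m lam : ℝ) : Set (Fin 4 → Fin 4 → ℝ) :=
  {s | IsPositiveSolution m lam s ∧
    ∃ x, Realizes x s ∧ (∃ i j, IsKiteWithAxis x i j) ∧ ¬ IsRhombus x}

/-- The non-rhombic kite solutions that are convex, with vortices `i` and `j` on the axis. -/
def convexKiteSolutions (m lam : ℝ) (i j : Fin 4) : Set (Fin 4 → Fin 4 → ℝ) :=
  {s ∈ kiteSolutions m lam | ∃ x, Realizes x s ∧ IsKiteWithAxis x i j ∧ IsConvexConfig x}

/-- The non-rhombic kite solutions that are concave, with vortices `i` and `j` on the axis. -/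
def concaveKiteSolutions (m lam : ℝ) (i j : Fin 4) : Set (Fin 4 → Fin 4 → ℝ) :=
  {s ∈ kiteSolutions m lam | ∃ x, Realizes x s ∧ IsKiteWithAxis x i j ∧ IsConcaveConfig x}

/-! Place the two axis vortices of a kite at abscissae u, v along the axis and the other two at
distance h on either side of it. Let μ be the strength off the axis divided by the strength on it.
The two strengths off the axis must agree: otherwise the unsymmetrized equations force both side
lengths squared to equal -1/λ', so u² = v² and the kite is a rhombus. Then the two strengths on the
axis agree as well. A dilation turns λ' < 0 into -1, and what remains is the system `KiteEquations`.

Write a = (u - v)², b = 4h², p = u² + h², q = v² + h², w = uv + h². Adding the two axis equations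
gives (u + v)(pq - w) = 0, and u + v = 0 is exactly the rhombus case, so pq = w. The identity pq =
w² + ab/4 yields ab = 4w(1 - w), and the cross equation becomes 2(1 - w) = μ(b - 1). Hence the
single number z = 2(1 - w) determines a, b, w and the pair {p, q}, and the last equation says
`kiteQuad μ z = 0` (`KiteEquations.exists_root`). Conversely, an admissible root gives u - v = √a
and u + v = √(a + 4w - b) (`exists_kiteEquations`). Each root thus yields two arrays, according to
which end of the axis is the farther one. The sign of uv = w - b/4 separates concave from convex.

It remains to count admissible roots: two for μ > 1, one (double) for μ = 1, none for 0 < μ < 1, one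
concave for -1/2 < μ < 0, one convex for μ < -2, none on [-2, -1/2]. The axis through 0, 1 has μ = m
and the axis through 2, 3 has μ = 1/m. For m ≠ 1 these are the only axes. For m = 1 the solutions
are equilateral triangles with their centre. -/

/-- Squared distance between the two vortices off the axis. -/
noncomputable def kiteB (m z : ℝ) : ℝ := 1 + z / m

/-- Product of the squared lengths of two adjacent sides joining the two ends of the axis. -/
noncomputable def kiteW (z : ℝ) : ℝ := 1 - z / 2

/-- Squared distance between the two vortices on the axis. -/
noncomputable def kiteA (m z : ℝ) : ℝ := z * (2 - z) / kiteB m z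

/-- The larger squared side length. -/
noncomputable def kiteP (m z : ℝ) : ℝ :=
  (kiteA m z + 2 * kiteW z + √(kiteA m z * (kiteA m z + 4 * kiteW z - kiteB m z))) / 2

/-- The smaller squared side length. -/
noncomputable def kiteQ (m z : ℝ) : ℝ :=
  (kiteA m z + 2 * kiteW z - √(kiteA m z * (kiteA m z + 4 * kiteW z - kiteB m z))) / 2

/-- The quadratic polynomial whose admissible roots parametrize the strict kites. -/
noncomputable def kiteQuad (m z : ℝ) : ℝ :=
  2 * m * (1 + m) * z ^ 2 + (1 + m) * (1 - 3 * m) * z + m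

/-- The roots of `kiteQuad` that give an actual kite, when the ratio of the strength off the axis
to the strength on the axis is `m`. -/
def kiteRoots (m : ℝ) : Set ℝ :=
  {z | 0 < z ∧ z < 2 ∧ 0 < kiteB m z ∧ kiteQuad m z = 0 ∧
    kiteB m z < kiteA m z + 4 * kiteW z}

/-! ### Admissible roots of the quadratic. -/

theorem kiteA_pos {m z : ℝ} (hz : z ∈ kiteRoots m) : 0 < kiteA m z := by
  obtain ⟨h0, h2, hb, -, -⟩ := hz
  exact div_pos (mul_pos h0 (by linarith)) hb

theorem kiteW_pos {m z : ℝ} (hz : z ∈ kiteRoots m) : 0 < kiteW z := by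
  obtain ⟨h0, h2, hb, -, -⟩ := hz
  unfold kiteW; linarith

theorem mem_kiteRoots_of_lt {m z : ℝ} (h0 : 0 < z) (h2 : z < 2) (hb : 0 < kiteB m z)
    (hF : kiteQuad m z = 0) (h : kiteB m z < 4 * kiteW z) : z ∈ kiteRoots m :=
  ⟨h0, h2, hb, hF, by linarith [show 0 < kiteA m z from div_pos (mul_pos h0 (by linarith)) hb]⟩

/-- Every real root is admissible: the quadratic is positive for z ≤ 0 and for z ≥ 3m/(2m+1), the
point where b = 4w, and its discriminant is positive. -/
theorem kiteRoots_of_one_lt {m : ℝ} (hm : 1 < m) :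
    (∃ z₁ z₂, z₁ ≠ z₂ ∧ kiteRoots m = {z₁, z₂}) ∧
      ∀ z ∈ kiteRoots m, kiteB m z < 4 * kiteW z := by
  have key : ∀ z, kiteQuad m z = 0 → z ∈ kiteRoots m ∧ kiteB m z < 4 * kiteW z := by
    intro z hF
    have hz0 : 0 < z := by
      by_contra hz
      have h1 : 0 ≤ (1 + m) * (3 * m - 1) * (-z) :=
        mul_nonneg (mul_nonneg (by linarith) (by linarith)) (by linarith)
      have h2 : 0 ≤ 2 * m * (1 + m) * z ^ 2 := by positivity
      unfold kiteQuad at hF; nlinarith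
    have hz1 : z * (2 * m + 1) < 3 * m := by
      by_contra hz
      push Not at hz
      -- Taylor expansion about z = 3m/(2m+1), with denominators cleared.
      have e : (2 * m + 1) ^ 2 * kiteQuad m z = m * (m + 2) ^ 2 + (1 + m) *
          (z * (2 * m + 1) - 3 * m) *
            (2 * m * (z * (2 * m + 1) - 3 * m) + (6 * m ^ 2 - m + 1)) := by
        unfold kiteQuad; ring
      rw [hF, mul_zero] at e
      have h1 : 0 ≤ (1 + m) * (z * (2 * m + 1) - 3 * m) *
            (2 * m * (z * (2 * m + 1) - 3 * m) + (6 * m ^ 2 - m + 1)) := by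
        refine mul_nonneg (mul_nonneg (by linarith) (by linarith)) (add_nonneg
          (mul_nonneg (by linarith) (by linarith)) (by nlinarith))
      have : 0 < m * (m + 2) ^ 2 := by positivity
      linarith
    have hb : 0 < kiteB m z := by unfold kiteB; positivity
    have hlt : kiteB m z < 4 * kiteW z := by
      have : z / m < 3 - 2 * z := by
        rw [div_lt_iff₀ (by linarith)]; linarith
      unfold kiteB kiteW; linarith
    refine ⟨mem_kiteRoots_of_lt hz0 ?_ hb hF hlt, hlt⟩
    nlinarith
  refine ⟨?_, fun z hz => (key z hz.2.2.2.1).2⟩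
  -- This product is the discriminant of `kiteQuad m`.
  have hd : 0 < (1 + m) * (m - 1) * (9 * m ^ 2 + 4 * m - 1) :=
    mul_pos (mul_pos (by linarith) (by linarith)) (by nlinarith)
  set r := √((1 + m) * (m - 1) * (9 * m ^ 2 + 4 * m - 1)) with hr
  have hr0 : 0 < r := Real.sqrt_pos.2 hd
  have hrr : r * r = (1 + m) * (m - 1) * (9 * m ^ 2 + 4 * m - 1) := Real.mul_self_sqrt hd.le
  have hlead : 2 * m * (1 + m) ≠ 0 := by positivity
  have hiff := quadratic_eq_zero_iff (b := (1 + m) * (1 - 3 * m)) (c := m) hlead (s := r)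
    (by rw [hrr, discrim]; ring)
  have hsq : ∀ z, kiteQuad m z =
      2 * m * (1 + m) * (z * z) + (1 + m) * (1 - 3 * m) * z + m := fun z => by
    rw [kiteQuad, sq]
  refine ⟨_, _, ?_, Set.ext fun z => ⟨fun hz => (hiff z).1 (hsq z ▸ hz.2.2.2.1),
    fun hz => (key z ((hsq z).trans ((hiff z).2 hz))).1⟩⟩
  rw [Ne, div_left_inj' (by positivity)]
  intro h; linarith

theorem kiteRoots_one : kiteRoots 1 = {1 / 2} := by
  ext z
  constructor
  · rintro ⟨-, -, -, hF, -⟩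
    have : (z - 1 / 2) ^ 2 = 0 := by unfold kiteQuad at hF; linarith
    have := pow_eq_zero_iff (two_ne_zero) |>.1 this
    rw [Set.mem_singleton_iff]; linarith
  · rintro rfl
    refine mem_kiteRoots_of_lt ?_ ?_ ?_ ?_ ?_ <;> norm_num [kiteQuad, kiteB, kiteW]

/-- For 3m ≤ 1 all coefficients are nonnegative, so no root is positive; for 1/3 < m < 1 the
discriminant is negative. -/
theorem kiteRoots_of_pos_of_lt_one {m : ℝ} (h0 : 0 < m) (h1 : m < 1) : kiteRoots m = ∅ := by
  refine Set.eq_empty_of_forall_notMem ?_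
  rintro z ⟨hz0, -, -, hF, -⟩
  unfold kiteQuad at hF
  rcases le_or_gt (3 * m) 1 with h | h
  · have : 0 ≤ (1 + m) * (1 - 3 * m) * z :=
      mul_nonneg (mul_nonneg (by linarith) (by linarith)) hz0.le
    have : 0 < 2 * m * (1 + m) * z ^ 2 := by positivity
    linarith
  · have hd : (1 + m) * (m - 1) * (9 * m ^ 2 + 4 * m - 1) < 0 :=
      mul_neg_of_neg_of_pos (mul_neg_of_pos_of_neg (by linarith) (by linarith)) (by nlinarith)
    have e : (4 * m * (1 + m) * z + (1 + m) * (1 - 3 * m)) ^ 2 =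
        (1 + m) * (m - 1) * (9 * m ^ 2 + 4 * m - 1) := by
      linear_combination 8 * m * (1 + m) * hF
    nlinarith [sq_nonneg (4 * m * (1 + m) * z + (1 + m) * (1 - 3 * m))]

theorem continuous_kiteQuad (m : ℝ) : Continuous (kiteQuad m) := by
  unfold kiteQuad; fun_prop

/-- Vieta: two distinct roots have product 1/(2(1+m)). The form without division also covers m = -1.
-/
theorem eq_of_kiteQuad_eq_zero {m y z : ℝ} (hm : m ≠ 0) (hy : kiteQuad m y = 0)
    (hz : kiteQuad m z = 0) (h : 2 * (1 + m) * (y * z) ≠ 1) : y = z := by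
  have e : m * (y - z) * (2 * (1 + m) * (y * z) - 1) = 0 := by
    unfold kiteQuad at hy hz
    linear_combination z * hy - y * hz
  rcases mul_eq_zero.1 e with e | e
  · exact sub_eq_zero.1 ((mul_eq_zero.1 e).resolve_left hm)
  · exact absurd (sub_eq_zero.1 e) h

theorem kiteRoots_of_mem_Ioo {m : ℝ} (hm : -1 / 2 < m) (hm0 : m < 0) :
    ∃ z, kiteRoots m = {z} ∧ kiteB m z < 4 * kiteW z := by
  have h0 : kiteQuad m 0 < 0 := by unfold kiteQuad; linarith
  -- The endpoint z = -m is where b vanishes; for m < 0, admissibility requires z < -m.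
  have h1 : 0 < kiteQuad m (-m) := by
    have : kiteQuad m (-m) = m ^ 2 * ((2 * m + 1) * (m + 2)) := by unfold kiteQuad; ring
    rw [this]
    exact mul_pos (sq_pos_of_neg hm0) (mul_pos (by linarith) (by linarith))
  obtain ⟨z, ⟨hz0, hz1⟩, hF⟩ := intermediate_value_Ioo (by linarith : (0 : ℝ) ≤ -m)
    (continuous_kiteQuad m).continuousOn ⟨h0, h1⟩
  have hb : 0 < kiteB m z := by
    have : -1 < z / m := by rw [lt_div_iff_of_neg hm0]; linarith
    unfold kiteB; linarith
  have hlt : kiteB m z < 4 * kiteW z := by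
    have : z / m < 0 := div_neg_of_pos_of_neg hz0 hm0
    unfold kiteB kiteW; linarith
  refine ⟨z, Set.eq_singleton_iff_unique_mem.2
    ⟨mem_kiteRoots_of_lt hz0 (by linarith) hb hF hlt, ?_⟩, hlt⟩
  rintro y ⟨hy0, -, hyb, hyF, -⟩
  have hy1 : y < -m := by
    have : -1 < y / m := by unfold kiteB at hyb; linarith
    rw [lt_div_iff_of_neg hm0] at this; linarith
  -- Both roots lie in (0, 1/2), so their product is too small for Vieta.
  refine eq_of_kiteQuad_eq_zero hm0.ne hyF hF (ne_of_lt ?_)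
  have : y * z < 1 / 2 * (1 / 2) :=
    mul_lt_mul'' (by linarith) (by linarith) hy0.le hz0.le
  have : 0 < y * z := mul_pos hy0 hz0
  nlinarith

theorem kiteRoots_of_lt_neg_two {m : ℝ} (hm : m < -2) :
    ∃ z, kiteRoots m = {z} ∧ 4 * kiteW z < kiteB m z := by
  have h0 : kiteQuad m 0 < 0 := by unfold kiteQuad; linarith
  have h1 : 0 < kiteQuad m 2 := by
    have : kiteQuad m 2 = (2 * m + 1) * (m + 2) := by unfold kiteQuad; ring
    rw [this]
    exact mul_pos_of_neg_of_neg (by linarith) (by linarith)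
  obtain ⟨z, ⟨hz0, hz1⟩, hF⟩ := intermediate_value_Ioo (by norm_num : (0 : ℝ) ≤ 2)
    (continuous_kiteQuad m).continuousOn ⟨h0, h1⟩
  have hm0 : m < 0 := by linarith
  have hmz : m + z < 0 := by linarith
  have hbe : kiteB m z = (m + z) / m := by
    rw [kiteB, add_div, div_self hm0.ne]
  have hb : 0 < kiteB m z := hbe ▸ div_pos_of_neg_of_neg hmz hm0
  have hgt : 4 * kiteW z < kiteB m z := by
    -- The boundary b = 4w is again z = 3m/(2m+1). Since 2m + 1 < 0, the inequality now places z
    -- beyond it, on the convex side.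
    have hz : z * (2 * m + 1) < 3 * m := by
      by_contra hz
      push Not at hz
      have e : (2 * m + 1) ^ 2 * kiteQuad m z = m * (m + 2) ^ 2 + (1 + m) *
          (z * (2 * m + 1) - 3 * m) *
            (2 * m * (z * (2 * m + 1)) + (1 - m)) := by
        unfold kiteQuad; ring
      rw [hF, mul_zero] at e
      have hneg : 2 * m * (z * (2 * m + 1)) + (1 - m) ≥ 0 := by
        have : 0 < z * (m * (2 * m + 1)) :=
          mul_pos hz0 (mul_pos_of_neg_of_neg hm0 (by linarith))
        linarith
      have : (1 + m) * (z * (2 * m + 1) - 3 * m) * (2 * m * (z * (2 * m + 1)) + (1 - m)) ≤ 0 :=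
        mul_nonpos_of_nonpos_of_nonneg
          (mul_nonpos_of_nonpos_of_nonneg (by linarith) (by linarith)) hneg
      have : m * (m + 2) ^ 2 < 0 :=
        mul_neg_of_neg_of_pos hm0 (sq_pos_of_neg (by linarith))
      linarith
    have : 3 - 2 * z < z / m := by
      rw [lt_div_iff_of_neg hm0]; linarith
    unfold kiteB kiteW; linarith
  -- Up to the positive factor 1/(m(m+z)) this is a + 4w - b, the future (u + v)². Modulo the
  -- quadratic, 2m times it is linear in z, increasing, and equal to -(m+2)(m-1) < 0 at z = 2.
  have hG : 0 < 3 * m ^ 2 + 2 * m * z - (m + 1) ^ 2 * z ^ 2 := by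
    have e : 2 * m * (3 * m ^ 2 + 2 * m * z - (m + 1) ^ 2 * z ^ 2) =
        m * (6 * m ^ 2 + m + 1) + z * (1 - m - m ^ 2 - 3 * m ^ 3) := by
      unfold kiteQuad at hF
      linear_combination (-(m + 1)) * hF
    have hc : 0 < 1 - m - m ^ 2 - 3 * m ^ 3 := by nlinarith [sq_nonneg m]
    have h2 : (m + 2) * (m - 1) > 0 := mul_pos_of_neg_of_neg (by linarith) (by linarith)
    nlinarith
  have hlt : kiteB m z < kiteA m z + 4 * kiteW z := by
    have hpos : 0 < m * (m + z) := mul_pos_of_neg_of_neg hm0 hmz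
    have : kiteA m z + 4 * kiteW z - kiteB m z =
        (3 * m ^ 2 + 2 * m * z - (m + 1) ^ 2 * z ^ 2) / (m * (m + z)) := by
      have := hmz.ne
      have := hm0.ne
      unfold kiteA kiteW
      rw [hbe]; field_simp; ring
    linarith [div_pos hG hpos]
  refine ⟨z, Set.eq_singleton_iff_unique_mem.2 ⟨⟨hz0, hz1, hb, hF, hlt⟩, ?_⟩, hgt⟩
  rintro y ⟨hy0, -, hyb, hyF, -⟩
  -- Distinct roots would have a negative product, because 1 + m < 0.
  refine eq_of_kiteQuad_eq_zero hm0.ne hyF hF (ne_of_lt ?_)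
  have : 0 < y * z := mul_pos hy0 hz0
  nlinarith

theorem kiteRoots_of_mem_Icc {m : ℝ} (hm : -2 ≤ m) (hm' : m ≤ -1 / 2) : kiteRoots m = ∅ := by
  refine Set.eq_empty_of_forall_notMem ?_
  rintro z ⟨hz0, hz2, hb, hF, -⟩
  have hm0 : m < 0 := by linarith
  have hzm : z < -m := by
    have : -1 < z / m := by unfold kiteB at hb; linarith
    rw [lt_div_iff_of_neg hm0] at this; linarith
  refine hF.not_lt ?_
  rcases le_or_gt m (-1) with h | h
  -- The quadratic is convex here, so on (0, 2) it lies below its chord; the end values m and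
  -- (2m+1)(m+2) are negative and nonpositive.
  · have e : 2 * kiteQuad m z = (2 * m + 1) * (m + 2) * z + m * (2 - z)
        - 4 * (m * (1 + m)) * (z * (2 - z)) := by unfold kiteQuad; ring
    have h1 : (2 * m + 1) * (m + 2) * z ≤ 0 :=
      mul_nonpos_of_nonpos_of_nonneg
        (mul_nonpos_of_nonpos_of_nonneg (by linarith) (by linarith)) hz0.le
    have h2 : m * (2 - z) < 0 := mul_neg_of_neg_of_pos hm0 (by linarith)
    have h3 : 0 ≤ 4 * (m * (1 + m)) * (z * (2 - z)) :=
      mul_nonneg (mul_nonneg (by norm_num) (mul_nonneg_of_nonpos_of_nonpos hm0.le (by linarith)))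
        (mul_nonneg hz0.le (by linarith))
    linarith
  -- Taylor expansion at z = -m: the value there is nonpositive, and the quadratic, now concave, has
  -- slope (1+m)²(1-4m) > 0 there.
  · have e : kiteQuad m z = m ^ 2 * ((2 * m + 1) * (m + 2))
        + (z + m) * (1 + m) * (2 * m * (z + m) + (1 - 3 * m - 4 * m ^ 2)) := by
      unfold kiteQuad; ring
    have h1 : m ^ 2 * ((2 * m + 1) * (m + 2)) ≤ 0 :=
      mul_nonpos_of_nonneg_of_nonpos (sq_nonneg m)
        (mul_nonpos_of_nonpos_of_nonneg (by linarith) (by linarith))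
    have h2 : (z + m) * (1 + m) < 0 := mul_neg_of_neg_of_pos (by linarith) (by linarith)
    have h3 : 0 < 2 * m * (z + m) := mul_pos_of_neg_of_neg (by linarith) (by linarith)
    have h4 : 0 < (1 - 4 * m) * (1 + m) := mul_pos (by linarith) (by linarith)
    have h5 := mul_neg_of_neg_of_pos h2
      (show 0 < 2 * m * (z + m) + (1 - 3 * m - 4 * m ^ 2) by linarith)
    linarith

/-! ### From kite equations to roots and back. -/

/-- The equations of a strict kite with axis end points `u`, `v` and half width `h`. -/
structure KiteEquations (m u v h : ℝ) : Prop where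
  axis_left : (((u - v) ^ 2)⁻¹ - 1) * (v - u) = 2 * m * u * ((u ^ 2 + h ^ 2)⁻¹ - 1)
  axis_right : (((u - v) ^ 2)⁻¹ - 1) * (u - v) = 2 * m * v * ((v ^ 2 + h ^ 2)⁻¹ - 1)
  cross : ((u ^ 2 + h ^ 2)⁻¹ - 1) + ((v ^ 2 + h ^ 2)⁻¹ - 1) + 2 * m * ((4 * h ^ 2)⁻¹ - 1) = 0

theorem KiteEquations.exists_root {m u v h : ℝ} (H : KiteEquations m u v h) (hm : m ≠ 0)
    (hh : 0 < h) (hne : u ≠ v) (hsum : u + v ≠ 0) :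
    ∃ z ∈ kiteRoots m, (u - v) ^ 2 = kiteA m z ∧ 4 * h ^ 2 = kiteB m z ∧
      u * v + h ^ 2 = kiteW z := by
  obtain ⟨H1, H2, H3⟩ := H
  have hp : 0 < u ^ 2 + h ^ 2 := by positivity
  have hq : 0 < v ^ 2 + h ^ 2 := by positivity
  have hd : u - v ≠ 0 := sub_ne_zero.2 hne
  have ha : 0 < (u - v) ^ 2 := by positivity
  have hpq : (u ^ 2 + h ^ 2) * (v ^ 2 + h ^ 2) = u * v + h ^ 2 := by
    have e : 2 * m * (u * ((u ^ 2 + h ^ 2)⁻¹ - 1) + v * ((v ^ 2 + h ^ 2)⁻¹ - 1)) = 0 := by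
      linear_combination -H1 - H2
    have e := (mul_eq_zero.1 e).resolve_left (by simpa using hm)
    field_simp at e
    have e' : (u + v) * ((u ^ 2 + h ^ 2) * (v ^ 2 + h ^ 2) - (u * v + h ^ 2)) = 0 := by
      linear_combination -e
    exact sub_eq_zero.1 ((mul_eq_zero.1 e').resolve_left hsum)
  set w := u * v + h ^ 2 with hw
  have hw0 : 0 < w := hpq ▸ mul_pos hp hq
  -- Lagrange's identity pq = w² + h²(u - v)², combined with pq = w.
  have hab : (u - v) ^ 2 * (4 * h ^ 2) = 4 * w * (1 - w) := by
    linear_combination 4 * hpq - 4 * (w + (u * v + h ^ 2)) * hw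
  have hpi : (u ^ 2 + h ^ 2)⁻¹ = (v ^ 2 + h ^ 2) / w := by rw [← hpq]; field_simp
  have hqi : (v ^ 2 + h ^ 2)⁻¹ = (u ^ 2 + h ^ 2) / w := by rw [← hpq]; field_simp
  have hw1 : 2 * (1 - w) = m * (4 * h ^ 2 - 1) := by
    rw [hpi, hqi] at H3
    field_simp at H3
    have e : 4 * w * (2 * (1 - w) - m * (4 * h ^ 2 - 1)) = 0 := by
      linear_combination 2 * H3 - 2 * hab - 16 * h ^ 2 * hw
    have := (mul_eq_zero.1 e).resolve_left (by positivity)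
    linarith
  have hz0 : 0 < 1 - w := by
    have : 0 < 4 * w * (1 - w) := hab ▸ by positivity
    exact (pos_iff_pos_of_mul_pos this).1 (by positivity)
  have hB : kiteB m (m * (4 * h ^ 2 - 1)) = 4 * h ^ 2 := by unfold kiteB; field_simp; ring
  have hW : kiteW (m * (4 * h ^ 2 - 1)) = w := by unfold kiteW; linarith
  have hA : kiteA m (m * (4 * h ^ 2 - 1)) = (u - v) ^ 2 := by
    unfold kiteA
    rw [hB, ← hw1, div_eq_iff (by positivity), hab]; ring
  refine ⟨m * (4 * h ^ 2 - 1), ⟨by linarith, by linarith, ?_, ?_, ?_⟩, hA.symm, hB.symm, hW.symm⟩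
  · rw [hB]; positivity
  · have h1 : (1 - (u - v) ^ 2) * w = (u - v) ^ 2 * (2 * m * (w - h ^ 2)) := by
      rw [hpi] at H1
      have e1 : (v ^ 2 + h ^ 2) / w - 1 = v * (v - u) / w := by
        rw [div_sub_one hw0.ne', hw]; ring
      rw [e1] at H1
      field_simp at H1
      linear_combination H1 - 2 * m * (u - v) ^ 2 * hw
    -- Multiply `h1` by b, eliminate ab through `hab`, and cancel w; only b and w are left, both
    -- affine in z.
    have h2 : 4 * h ^ 2 - 4 * w * (1 - w) = 4 * (1 - w) * (2 * m * (w - h ^ 2)) := by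
      refine mul_left_cancel₀ hw0.ne' ?_
      linear_combination (4 * h ^ 2) * h1 + (w + 2 * m * (w - h ^ 2)) * hab
    have hw2 : w = 1 - m * (4 * h ^ 2 - 1) / 2 := by linarith
    rw [hw2] at h2
    unfold kiteQuad
    linear_combination m * h2
  · rw [hA, hB, hW]
    have : 0 < (u + v) ^ 2 := by positivity
    rw [hw]; nlinarith

/-- The reduction read backwards. Choosing u + v > 0 and u > v makes the first end the farther one,
which matches p > q. -/
theorem exists_kiteEquations {m z : ℝ} (hm : m ≠ 0) (hz : z ∈ kiteRoots m) :
    ∃ u v h : ℝ, 0 < h ∧ v < u ∧ 0 < u + v ∧ KiteEquations m u v h ∧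
      (u - v) ^ 2 = kiteA m z ∧ 4 * h ^ 2 = kiteB m z ∧ u ^ 2 + h ^ 2 = kiteP m z ∧
        v ^ 2 + h ^ 2 = kiteQ m z := by
  have ha := kiteA_pos hz
  have hw := kiteW_pos hz
  obtain ⟨hz0, hz2, hb, hF, he⟩ := hz
  have hab : kiteA m z * kiteB m z = 4 * kiteW z * (1 - kiteW z) := by
    unfold kiteA kiteW; field_simp; ring
  have hm3 : (1 - kiteA m z) * kiteW z =
      kiteA m z * (2 * m * (kiteW z - kiteB m z / 4)) := by
    have h2 : kiteB m z - 4 * kiteW z * (1 - kiteW z) =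
        4 * (1 - kiteW z) * (2 * m * (kiteW z - kiteB m z / 4)) := by
      have ht : m * (z / m) = z := mul_div_cancel₀ z hm
      refine mul_left_cancel₀ hm ?_
      unfold kiteB kiteW; unfold kiteQuad at hF
      linear_combination hF + (1 + m * z) * ht
    refine mul_left_cancel₀ hb.ne' ?_
    linear_combination kiteW z * h2 -
      (kiteW z + 2 * m * (kiteW z - kiteB m z / 4)) * hab
  have hm2 : 2 * (1 - kiteW z) = m * (kiteB m z - 1) := by
    unfold kiteB kiteW; field_simp; ring
  have hP : kiteP m z = (kiteA m z + 2 * kiteW z + √(kiteA m z) *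
      √(kiteA m z + 4 * kiteW z - kiteB m z)) / 2 := by
    rw [kiteP, Real.sqrt_mul ha.le]
  have hQ : kiteQ m z = (kiteA m z + 2 * kiteW z - √(kiteA m z) *
      √(kiteA m z + 4 * kiteW z - kiteB m z)) / 2 := by
    rw [kiteQ, Real.sqrt_mul ha.le]
  rw [hP, hQ]
  clear hP hQ hF
  generalize kiteA m z = a at *
  generalize kiteB m z = b at *
  generalize kiteW z = w at *
  have hd := Real.sqrt_pos.2 ha
  have hd2 := Real.sq_sqrt ha.le
  have hE := Real.sqrt_pos.2 (show 0 < a + 4 * w - b by linarith)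
  have hE2 := Real.sq_sqrt (show 0 ≤ a + 4 * w - b by linarith)
  have hh := Real.sqrt_pos.2 hb
  have hh2 := Real.sq_sqrt hb.le
  set d := √a
  set e := √(a + 4 * w - b)
  set g := √b
  have hp : ((e + d) / 2) ^ 2 + (g / 2) ^ 2 = (a + 2 * w + d * e) / 2 := by
    linear_combination (hd2 + hE2 + hh2) / 4
  have hq : ((e - d) / 2) ^ 2 + (g / 2) ^ 2 = (a + 2 * w - d * e) / 2 := by
    linear_combination (hd2 + hE2 + hh2) / 4
  have hA : ((e + d) / 2 - (e - d) / 2) ^ 2 = a := by linear_combination hd2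
  have hB : 4 * (g / 2) ^ 2 = b := by linear_combination hh2
  have hp0 : 0 < (a + 2 * w + d * e) / 2 := by positivity
  have hq0 : 0 < (a + 2 * w - d * e) / 2 := by rw [← hq]; positivity
  -- Knowing pq = w turns the inverses of p and q into q/w and p/w, after which the equations are
  -- polynomial.
  have hpq : (a + 2 * w + d * e) / 2 * ((a + 2 * w - d * e) / 2) = w := by
    linear_combination (-e ^ 2 / 4) * hd2 - a / 4 * hE2 + hab / 4
  have hpi : ((a + 2 * w + d * e) / 2)⁻¹ = (a + 2 * w - d * e) / 2 / w := by
    rw [eq_div_iff hw.ne', inv_mul_eq_iff_eq_mul₀ hp0.ne', hpq]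
  have hqi : ((a + 2 * w - d * e) / 2)⁻¹ = (a + 2 * w + d * e) / 2 / w := by
    rw [eq_div_iff hw.ne', inv_mul_eq_iff_eq_mul₀ hq0.ne', mul_comm, hpq]
  have hA' : (a⁻¹ - 1) * w = 2 * m * (w - b / 4) := by
    refine mul_left_cancel₀ ha.ne' ?_
    linear_combination hm3 + w * mul_inv_cancel₀ ha.ne'
  have hX := div_mul_cancel₀ ((a + 2 * w - d * e) / 2) hw.ne'
  have hY := div_mul_cancel₀ ((a + 2 * w + d * e) / 2) hw.ne'
  refine ⟨(e + d) / 2, (e - d) / 2, g / 2, by positivity, by linarith, by linarith,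
    ⟨?_, ?_, ?_⟩, hA, hB, hp, hq⟩
  · rw [hA, hp, hpi]
    refine mul_right_cancel₀ hw.ne' ?_
    linear_combination (-d) * hA' - m * (e + d) * hX + m * e / 2 * hd2 + m * d / 2 * hE2
  · rw [hA, hq, hqi]
    refine mul_right_cancel₀ hw.ne' ?_
    linear_combination d * hA' - m * (e - d) * hY + m * e / 2 * hd2 - m * d / 2 * hE2
  · rw [hp, hq, hB, hpi, hqi]
    refine mul_left_cancel₀ (mul_pos hw hb).ne' ?_
    linear_combination b * hX + b * hY + 2 * m * w * mul_inv_cancel₀ hb.ne' + hab + 2 * w * hm2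

/-! ### Labellings and planar coordinates of a kite. -/

theorem eq_or_of_nodup_four {i j k l : Fin 4} (h : [i, j, k, l].Nodup) (r : Fin 4) :
    r = i ∨ r = j ∨ r = k ∨ r = l := by
  revert i j k l r; decide

theorem sum_eq_of_nodup_four {i j k l : Fin 4} (h : [i, j, k, l].Nodup) (f : Fin 4 → ℝ) :
    ∑ r, f r = f i + f j + f k + f l := by
  have hu : (Finset.univ : Finset (Fin 4)) = {i, j, k, l} := by
    ext r; simpa using eq_or_of_nodup_four h r
  simp only [List.nodup_cons, List.mem_cons, List.not_mem_nil, or_false, not_or,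
    not_false_eq_true, List.nodup_nil, and_true] at h
  obtain ⟨⟨h1, h2, h3⟩, ⟨h4, h5⟩, h6⟩ := h
  rw [hu, Finset.sum_insert (by simp [*]), Finset.sum_insert (by simp [*]),
    Finset.sum_insert (by simp [*]), Finset.sum_singleton]
  ring

theorem exists_nodup_four {i j : Fin 4} (h : i ≠ j) : ∃ k l, [i, j, k, l].Nodup := by
  revert i j; decide

theorem dist_sq_plane (x y : EuclideanSpace ℝ (Fin 2)) :
    dist x y ^ 2 = (x 0 - y 0) ^ 2 + (x 1 - y 1) ^ 2 := by
  rw [EuclideanSpace.dist_eq, Real.sq_sqrt (by positivity), Fin.sum_univ_two, Real.dist_eq,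
    Real.dist_eq, sq_abs, sq_abs]

/-- Coordinates adapted to a kite: the axis passes through `(o₀, o₁)` with unit direction
`(-n₁, n₀)`, the vortices `x i`, `x j` sit at abscissae `u`, `v` of the axis, and `x k`, `x l` at
distance `h` on both sides. -/
structure KiteFrame (x : Fin 4 → EuclideanSpace ℝ (Fin 2)) (i j k l : Fin 4)
    (o₀ o₁ n₀ n₁ u v h : ℝ) : Prop where
  unit : n₀ ^ 2 + n₁ ^ 2 = 1
  pos : 0 < h
  i₀ : x i 0 = o₀ - u * n₁
  i₁ : x i 1 = o₁ + u * n₀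
  j₀ : x j 0 = o₀ - v * n₁
  j₁ : x j 1 = o₁ + v * n₀
  k₀ : x k 0 = o₀ - h * n₀
  k₁ : x k 1 = o₁ - h * n₁
  l₀ : x l 0 = o₀ + h * n₀
  l₁ : x l 1 = o₁ + h * n₁

/-- The origin is the midpoint of `x k` and `x l`, and the unit normal points from `x k` to `x l`.
Equidistance makes `x i` and `x j` orthogonal to it. -/
theorem exists_kiteFrame {x : Fin 4 → EuclideanSpace ℝ (Fin 2)} {i j k l : Fin 4}
    (hkl : x k ≠ x l) (hi : dist (x i) (x k) ^ 2 = dist (x i) (x l) ^ 2)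
    (hj : dist (x j) (x k) ^ 2 = dist (x j) (x l) ^ 2) :
    ∃ o₀ o₁ n₀ n₁ u v h, KiteFrame x i j k l o₀ o₁ n₀ n₁ u v h := by
  have hpos : 0 < dist (x k) (x l) ^ 2 := pow_pos (dist_pos.2 hkl) 2
  rw [dist_sq_plane] at hpos
  rw [dist_sq_plane, dist_sq_plane] at hi hj
  set D₀ := (x l 0 - x k 0) / 2 with hD₀
  set D₁ := (x l 1 - x k 1) / 2 with hD₁
  have hD : 0 < D₀ ^ 2 + D₁ ^ 2 := by rw [hD₀, hD₁]; linarith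
  set h := √(D₀ ^ 2 + D₁ ^ 2)
  have hh : 0 < h := Real.sqrt_pos.2 hD
  have hh2 : h ^ 2 = D₀ ^ 2 + D₁ ^ 2 := Real.sq_sqrt hD.le
  have e₀ : h * (D₀ / h) = D₀ := mul_div_cancel₀ _ hh.ne'
  have e₁ : h * (D₁ / h) = D₁ := mul_div_cancel₀ _ hh.ne'
  have hu : (D₀ / h) ^ 2 + (D₁ / h) ^ 2 = 1 := by field_simp; exact hh2.symm
  set n₀ := D₀ / h
  set n₁ := D₁ / h
  have perp : ∀ y : EuclideanSpace ℝ (Fin 2), (y 0 - x k 0) ^ 2 + (y 1 - x k 1) ^ 2 =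
      (y 0 - x l 0) ^ 2 + (y 1 - x l 1) ^ 2 →
      (y 0 - (x k 0 + x l 0) / 2) * n₀ + (y 1 - (x k 1 + x l 1) / 2) * n₁ = 0 := by
    intro y hy
    refine mul_left_cancel₀ hh.ne' ?_
    linear_combination (y 0 - (x k 0 + x l 0) / 2) * e₀ + (y 1 - (x k 1 + x l 1) / 2) * e₁ +
      hy / 4 + (y 0 - (x k 0 + x l 0) / 2) * hD₀ + (y 1 - (x k 1 + x l 1) / 2) * hD₁
  have pi := perp _ hi
  have pj := perp _ hj
  refine ⟨(x k 0 + x l 0) / 2, (x k 1 + x l 1) / 2, n₀, n₁,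
    -(x i 0 - (x k 0 + x l 0) / 2) * n₁ + (x i 1 - (x k 1 + x l 1) / 2) * n₀,
    -(x j 0 - (x k 0 + x l 0) / 2) * n₁ + (x j 1 - (x k 1 + x l 1) / 2) * n₀, h,
    hu, hh, ?_, ?_, ?_, ?_, ?_, ?_, ?_, ?_⟩
  · linear_combination n₀ * pi - (x i 0 - (x k 0 + x l 0) / 2) * hu
  · linear_combination n₁ * pi - (x i 1 - (x k 1 + x l 1) / 2) * hu
  · linear_combination n₀ * pj - (x j 0 - (x k 0 + x l 0) / 2) * hu
  · linear_combination n₁ * pj - (x j 1 - (x k 1 + x l 1) / 2) * hu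
  · rw [e₀, hD₀]; ring
  · rw [e₁, hD₁]; ring
  · rw [e₀, hD₀]; ring
  · rw [e₁, hD₁]; ring

namespace KiteFrame

variable {x : Fin 4 → EuclideanSpace ℝ (Fin 2)} {i j k l : Fin 4} {o₀ o₁ n₀ n₁ u v h : ℝ}

theorem swap_axis (F : KiteFrame x i j k l o₀ o₁ n₀ n₁ u v h) :
    KiteFrame x j i k l o₀ o₁ n₀ n₁ v u h :=
  ⟨F.unit, F.pos, F.j₀, F.j₁, F.i₀, F.i₁, F.k₀, F.k₁, F.l₀, F.l₁⟩

theorem swap_sides (F : KiteFrame x i j k l o₀ o₁ n₀ n₁ u v h) :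
    KiteFrame x i j l k o₀ o₁ (-n₀) (-n₁) (-u) (-v) h :=
  ⟨by rw [neg_sq, neg_sq, F.unit], F.pos, by rw [F.i₀]; ring, by rw [F.i₁]; ring,
    by rw [F.j₀]; ring, by rw [F.j₁]; ring, by rw [F.l₀]; ring, by rw [F.l₁]; ring,
    by rw [F.k₀]; ring, by rw [F.k₁]; ring⟩

theorem dist_ij (F : KiteFrame x i j k l o₀ o₁ n₀ n₁ u v h) :
    dist (x i) (x j) ^ 2 = (u - v) ^ 2 := by
  rw [dist_sq_plane, F.i₀, F.i₁, F.j₀, F.j₁]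
  linear_combination (u - v) ^ 2 * F.unit

theorem dist_kl (F : KiteFrame x i j k l o₀ o₁ n₀ n₁ u v h) :
    dist (x k) (x l) ^ 2 = 4 * h ^ 2 := by
  rw [dist_sq_plane, F.k₀, F.k₁, F.l₀, F.l₁]
  linear_combination 4 * h ^ 2 * F.unit

theorem dist_ik (F : KiteFrame x i j k l o₀ o₁ n₀ n₁ u v h) :
    dist (x i) (x k) ^ 2 = u ^ 2 + h ^ 2 := by
  rw [dist_sq_plane, F.i₀, F.i₁, F.k₀, F.k₁]
  linear_combination (u ^ 2 + h ^ 2) * F.unit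

theorem dist_il (F : KiteFrame x i j k l o₀ o₁ n₀ n₁ u v h) :
    dist (x i) (x l) ^ 2 = u ^ 2 + h ^ 2 := by
  rw [F.swap_sides.dist_ik, neg_sq]

theorem dist_jk (F : KiteFrame x i j k l o₀ o₁ n₀ n₁ u v h) :
    dist (x j) (x k) ^ 2 = v ^ 2 + h ^ 2 := F.swap_axis.dist_ik

theorem dist_jl (F : KiteFrame x i j k l o₀ o₁ n₀ n₁ u v h) :
    dist (x j) (x l) ^ 2 = v ^ 2 + h ^ 2 := F.swap_axis.dist_il

/-- If `x i` is between the foot of the altitude and the apex `x j`, it is interior to the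
triangle of the three other vortices. -/
theorem isConcaveConfig_of_lt (F : KiteFrame x i j k l o₀ o₁ n₀ n₁ u v h)
    (hij : i ≠ j) (hik : i ≠ k) (hil : i ≠ l) (h0 : 0 < u / v) (h1 : u / v < 1) :
    IsConcaveConfig x := by
  have hv : v ≠ 0 := by rintro rfl; simp at h0
  have hh := F.pos
  have hu := F.unit
  refine ⟨i, ?_⟩
  let t : EuclideanSpace ℝ (Fin 2) → ℝ := fun y => (-(y 0 - o₀) * n₁ + (y 1 - o₁) * n₀) / v
  let c : EuclideanSpace ℝ (Fin 2) → ℝ := fun y => ((y 0 - o₀) * n₀ + (y 1 - o₁) * n₁) / h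
  have ht : Continuous t := by fun_prop
  have hc : Continuous c := by fun_prop
  -- In the barycentric weights t, (1-t+c)/2, (1-t-c)/2 of `x j`, `x l`, `x k`, this is the open
  -- triangle.
  let U : Set (EuclideanSpace ℝ (Fin 2)) := {y | 0 < t y} ∩ ({y | c y < 1 - t y} ∩
    {y | -c y < 1 - t y})
  have hU : IsOpen U := (isOpen_lt continuous_const ht).inter
    ((isOpen_lt hc (by fun_prop)).inter (isOpen_lt hc.neg (by fun_prop)))
  refine mem_interior.2 ⟨U, ?_, hU, ?_⟩
  · rintro y ⟨y1, y2, y3⟩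
    simp only [Set.mem_ofPred_eq] at y1 y2 y3
    have hmem : ∀ r, r ≠ i → x r ∈ convexHull ℝ (x '' {i}ᶜ) := fun r hr =>
      subset_convexHull ℝ _ ⟨r, hr, rfl⟩
    have hconv := (convex_convexHull ℝ (x '' {i}ᶜ)).sum_mem (t := Finset.univ)
      (w := ![t y, (1 - t y + c y) / 2, (1 - t y - c y) / 2]) (z := ![x j, x l, x k])
      (by
        intro r _
        fin_cases r <;> simp <;> linarith)
      (by simp [Fin.sum_univ_three]; ring)
      (by
        intro r _
        fin_cases r
        · exact hmem j hij.symm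
        · exact hmem l hil.symm
        · exact hmem k hik.symm)
    convert hconv using 1
    have e1 : v * t y = -(y 0 - o₀) * n₁ + (y 1 - o₁) * n₀ := mul_div_cancel₀ _ hv
    have e2 : h * c y = (y 0 - o₀) * n₀ + (y 1 - o₁) * n₁ := mul_div_cancel₀ _ hh.ne'
    ext r
    fin_cases r
    · simp [Fin.sum_univ_three, F.j₀, F.k₀, F.l₀]
      linear_combination n₁ * e1 - n₀ * e2 - (y 0 - o₀) * hu
    · simp [Fin.sum_univ_three, F.j₁, F.k₁, F.l₁]
      linear_combination -n₀ * e1 - n₁ * e2 - (y 1 - o₁) * hu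
  · have e1 : t (x i) = u / v := by
      simp only [t, F.i₀, F.i₁]; congr 1; linear_combination u * hu
    have e2 : c (x i) = 0 := by
      simp only [c, F.i₀, F.i₁]
      rw [div_eq_zero_iff]; left; ring
    refine ⟨?_, ?_, ?_⟩ <;> simp only [Set.mem_ofPred_eq, e1, e2] <;> linarith

theorem isConcaveConfig (F : KiteFrame x i j k l o₀ o₁ n₀ n₁ u v h) (hn : [i, j, k, l].Nodup)
    (hne : u ≠ v) (h0 : 0 < u * v) : IsConcaveConfig x := by
  simp only [List.nodup_cons, List.mem_cons, List.not_mem_nil, or_false, not_or] at hn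
  obtain ⟨⟨h1, h2, h3⟩, ⟨h4, h5⟩, h6⟩ := hn
  have hu : u ≠ 0 := left_ne_zero_of_mul h0.ne'
  have hv : v ≠ 0 := right_ne_zero_of_mul h0.ne'
  have p1 : 0 < u / v := by
    rw [show u / v = u * v / v ^ 2 by field_simp]; positivity
  rcases lt_or_ge (u / v) 1 with hlt | hge
  · exact F.isConcaveConfig_of_lt h1 h2 h3 p1 hlt
  · refine F.swap_axis.isConcaveConfig_of_lt (Ne.symm h1) h4 h5 (by
      rw [← inv_div]; positivity) ?_
    rw [← inv_div]
    refine inv_lt_one_of_one_lt₀ (lt_of_le_of_ne hge fun h => hne ?_)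
    rw [eq_comm, div_eq_one_iff_eq hv] at h
    exact h

/-- Each vortex is strictly separated from the other three: an axis end by the line through `x k`
and `x l`, an off-axis vortex by the axis. -/
theorem isConvexConfig (F : KiteFrame x i j k l o₀ o₁ n₀ n₁ u v h) (hn : [i, j, k, l].Nodup)
    (h0 : u * v < 0) : IsConvexConfig x := by
  have hh := F.pos
  have hu := F.unit
  have sep : ∀ r (α β γ : ℝ), (∀ t, t ≠ r → α * x t 0 + β * x t 1 ≤ γ) →
      γ < α * x r 0 + β * x r 1 → ∀ s : Set (Fin 4), x r ∉ convexHull ℝ (x '' (s \ {r})) := by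
    intro r α β γ hle hlt s hmem
    have hc : Convex ℝ {y : EuclideanSpace ℝ (Fin 2) | α * y 0 + β * y 1 ≤ γ} := by
      intro y hy z hz a b ha hb hab
      simp only [Set.mem_ofPred_eq, PiLp.add_apply, PiLp.smul_apply, smul_eq_mul] at hy hz ⊢
      have := add_le_add (mul_le_mul_of_nonneg_left hy ha) (mul_le_mul_of_nonneg_left hz hb)
      have e : a * γ + b * γ = γ := by rw [← add_mul, hab, one_mul]
      linarith
    have := convexHull_min (s := x '' (s \ {r})) (by
      rintro _ ⟨t, ht, rfl⟩; exact hle t ht.2) hc hmem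
    exact absurd this (not_le.2 hlt)
  have hi : ∀ {i j u v n₀ n₁}, KiteFrame x i j k l o₀ o₁ n₀ n₁ u v h → [i, j, k, l].Nodup →
      u * v < 0 →
      ∀ s : Set (Fin 4), x i ∉ convexHull ℝ (x '' (s \ {i})) := by
    intro i j u v n₀ n₁ F hn h0
    have hu := F.unit
    -- The functional is u times the abscissa along the axis; the factor u gives the right
    -- orientation for either sign of u.
    refine sep i (-u * n₁) (u * n₀) (-u * n₁ * o₀ + u * n₀ * o₁) ?_ ?_
    · intro t ht
      rcases eq_or_of_nodup_four hn t with rfl | rfl | rfl | rfl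
      · exact absurd rfl ht
      · rw [F.j₀, F.j₁]; linear_combination h0 + u * v * hu
      · rw [F.k₀, F.k₁]; linarith
      · rw [F.l₀, F.l₁]; linarith
    · have : 0 < u ^ 2 := by
        have : u ≠ 0 := left_ne_zero_of_mul h0.ne
        positivity
      rw [F.i₀, F.i₁]; linear_combination this - u ^ 2 * hu
  have hk : ∀ {k l u v n₀ n₁}, KiteFrame x i j k l o₀ o₁ n₀ n₁ u v h → [i, j, k, l].Nodup →
      ∀ s : Set (Fin 4), x l ∉ convexHull ℝ (x '' (s \ {l})) := by
    intro k l u v n₀ n₁ F hn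
    have hu := F.unit
    refine sep l n₀ n₁ (n₀ * o₀ + n₁ * o₁) ?_ ?_
    · intro t ht
      rcases eq_or_of_nodup_four hn t with rfl | rfl | rfl | rfl
      · rw [F.i₀, F.i₁]; linarith
      · rw [F.j₀, F.j₁]; linarith
      · rw [F.k₀, F.k₁]; linear_combination hh - h * hu
      · exact absurd rfl ht
    · rw [F.l₀, F.l₁]; linear_combination hh - h * hu
  refine convexIndependent_iff_notMem_convexHull_sdiff.2 fun r s => ?_
  have hn1 : [j, i, k, l].Nodup := (List.Perm.swap _ _ _).nodup_iff.1 hn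
  have hn2 : [i, j, l, k].Nodup := (((List.Perm.swap _ _ _).cons _).cons _).nodup_iff.1 hn
  rcases eq_or_of_nodup_four hn r with rfl | rfl | rfl | rfl
  · exact hi F hn h0 s
  · exact hi F.swap_axis hn1 (by linarith) s
  · exact hk F.swap_sides hn2 s
  · exact hk F hn s

/-- A kite is a rhombus exactly when the two ends of the axis are opposite. -/
theorem isRhombus_iff (F : KiteFrame x i j k l o₀ o₁ n₀ n₁ u v h) (hn : [i, j, k, l].Nodup)
    (hx : Function.Injective x) : IsRhombus x ↔ u + v = 0 := by
  have key : ∀ {a b : ℝ}, 0 ≤ a → 0 ≤ b → a ^ 2 = b ^ 2 → a = b := fun ha hb hab =>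
    (sq_eq_sq₀ ha hb).1 hab
  have hij : u - v ≠ 0 := by
    intro h0
    have h1 := F.dist_ij
    rw [h0] at h1
    have : i = j := hx (dist_eq_zero.1 (pow_eq_zero_iff two_ne_zero |>.1 (by simpa using h1)))
    simp [this] at hn
  constructor
  · rintro ⟨-, i', j', k', l', hn', e1, e2, e3⟩
    replace e1 := congrArg (fun t : ℝ => t ^ 2) e1
    replace e2 := congrArg (fun t : ℝ => t ^ 2) e2
    replace e3 := congrArg (fun t : ℝ => t ^ 2) e3
    beta_reduce at e1 e2 e3
    have hsq : u ^ 2 = v ^ 2 := by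
      have d1 := F.dist_ij; have d2 := F.dist_kl; have d3 := F.dist_ik; have d4 := F.dist_il
      have d5 := F.dist_jk; have d6 := F.dist_jl
      have d1' := d1; have d2' := d2; have d3' := d3; have d4' := d4
      have d5' := d5; have d6' := d6
      rw [dist_comm] at d1' d2' d3' d4' d5' d6'
      -- A cycle through the four vortices omits only one perfect matching, so it contains a side at
      -- `i` and a side at `j` of squared lengths p and q. Equal sides always force p = q.
      rcases eq_or_of_nodup_four hn i' with rfl | rfl | rfl | rfl <;>
      rcases eq_or_of_nodup_four hn j' with rfl | rfl | rfl | rfl <;>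
      first
      | (exfalso; simp at hn'; done)
      | (rcases eq_or_of_nodup_four hn k' with rfl | rfl | rfl | rfl <;>
        first
        | (exfalso; simp at hn'; done)
        | (rcases eq_or_of_nodup_four hn l' with rfl | rfl | rfl | rfl <;>
          first
          | (exfalso; simp at hn'; done)
          | linarith))
    have : (u - v) * (u + v) = 0 := by linear_combination hsq
    exact (mul_eq_zero.1 this).resolve_left hij
  · intro hs
    have hsq : u ^ 2 = v ^ 2 := by rw [eq_neg_of_add_eq_zero_left hs, neg_sq]
    refine ⟨hx, i, j, k, l, hn, ?_, ?_, ?_⟩ <;> refine key dist_nonneg dist_nonneg ?_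
    · rw [F.dist_ik, dist_comm, F.dist_jk, hsq]
    · rw [dist_comm, F.dist_jk, F.dist_jl]
    · rw [F.dist_jl, dist_comm, F.dist_il, hsq]

end KiteFrame

/-! ### Arrays of squared distances and their realizations. -/

theorem cayleyMenger_eq_zero_of_realizes {x : Fin 4 → EuclideanSpace ℝ (Fin 2)}
    {s : Fin 4 → Fin 4 → ℝ} (hs : Realizes x s) : cayleyMenger s = 0 := by
  have h : ∀ i j, s i j = ((x i 0 - x 0 0) - (x j 0 - x 0 0)) ^ 2 +
      ((x i 1 - x 0 1) - (x j 1 - x 0 1)) ^ 2 := fun i j => by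
    rw [hs, dist_sq_plane]; ring
  unfold cayleyMenger
  rw [h 0 1, h 0 2, h 0 3, h 1 2, h 1 3, h 2 3]
  generalize x 1 0 - x 0 0 = a
  generalize x 1 1 - x 0 1 = b
  generalize x 2 0 - x 0 0 = c
  generalize x 2 1 - x 0 1 = d
  generalize x 3 0 - x 0 0 = e
  generalize x 3 1 - x 0 1 = f
  simp [Matrix.det_succ_row_zero, Fin.sum_univ_succ, Fin.succAbove]
  ring

/-- The symmetric array of a kite with `i` and `j` on the axis. -/
noncomputable def kiteArray (i j : Fin 4) (a b p q : ℝ) (r t : Fin 4) : ℝ :=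
  if r = t then 0 else if (r = i ∧ t = j) ∨ (r = j ∧ t = i) then a
  else if r = i ∨ t = i then p else if r = j ∨ t = j then q else b

/-- The array of squared distances attached to a root; `i` is the end of the axis that is farther
from the two symmetric vortices. -/
noncomputable def rootArray (i j : Fin 4) (m z : ℝ) : Fin 4 → Fin 4 → ℝ :=
  kiteArray i j (kiteA m z) (kiteB m z) (kiteP m z) (kiteQ m z)

/-- The arrays of squared distances of the strict kites with `i` and `j` on the axis. -/
def axisSolutions (i j : Fin 4) (m : ℝ) : Set (Fin 4 → Fin 4 → ℝ) :=
  {s | ∃ z ∈ kiteRoots m, s = rootArray i j m z ∨ s = rootArray j i m z}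

theorem axisSolutions_comm (i j : Fin 4) (m : ℝ) : axisSolutions i j m = axisSolutions j i m := by
  ext s; simp only [axisSolutions, Set.mem_ofPred_eq, or_comm]

theorem nodup_four_iff {i j k l : Fin 4} : [i, j, k, l].Nodup ↔
    i ≠ j ∧ i ≠ k ∧ i ≠ l ∧ j ≠ k ∧ j ≠ l ∧ k ≠ l := by
  simp; tauto

theorem kiteArray_eq {i j k l : Fin 4} (hn : [i, j, k, l].Nodup) {s : Fin 4 → Fin 4 → ℝ}
    (hd : ∀ r, s r r = 0) (hs : ∀ r t, s r t = s t r) {a b p q : ℝ} (hij : s i j = a)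
    (hkl : s k l = b) (hik : s i k = p) (hil : s i l = p) (hjk : s j k = q) (hjl : s j l = q) :
    s = kiteArray i j a b p q := by
  obtain ⟨h1, h2, h3, h4, h5, h6⟩ := nodup_four_iff.1 hn
  have g1 := h1.symm; have g2 := h2.symm; have g3 := h3.symm
  have g4 := h4.symm; have g5 := h5.symm; have g6 := h6.symm
  have e1 := hs j i; have e2 := hs l k; have e3 := hs k i; have e4 := hs l i
  have e5 := hs k j; have e6 := hs l j
  funext r t
  rcases eq_or_of_nodup_four hn r with hr | hr | hr | hr <;>
  rcases eq_or_of_nodup_four hn t with ht | ht | ht | ht <;>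
  rw [hr, ht] <;> simp [kiteArray, *]

theorem kiteP_add_kiteQ (m z : ℝ) : kiteP m z + kiteQ m z = kiteA m z + 2 * kiteW z := by
  unfold kiteP kiteQ; ring

theorem kiteQ_lt_kiteP {m z : ℝ} (hz : z ∈ kiteRoots m) : kiteQ m z < kiteP m z := by
  have h : 0 < √(kiteA m z * (kiteA m z + 4 * kiteW z - kiteB m z)) :=
    Real.sqrt_pos.2 (mul_pos (kiteA_pos hz) (by linarith [hz.2.2.2.2]))
  unfold kiteP kiteQ; linarith

theorem rootArray_kl {i j k l : Fin 4} (hn : [i, j, k, l].Nodup) (m z : ℝ) :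
    rootArray i j m z k l = kiteB m z := by
  obtain ⟨h1, h2, h3, h4, h5, h6⟩ := nodup_four_iff.1 hn
  simp [rootArray, kiteArray, *, h2.symm, h3.symm, h4.symm, h5.symm]

theorem rootArray_ij {i j : Fin 4} (hn : i ≠ j) (m z : ℝ) :
    rootArray i j m z i j = kiteA m z := by
  simp [rootArray, kiteArray, hn]

theorem rootArray_ik {i j k : Fin 4} (hik : i ≠ k) (hjk : j ≠ k) (m z : ℝ) :
    rootArray i j m z i k = kiteP m z := by
  simp [rootArray, kiteArray, hik, hik.symm, hjk.symm]

theorem rootArray_jk {i j k : Fin 4} (hij : i ≠ j) (hik : i ≠ k) (hjk : j ≠ k) (m z : ℝ) :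
    rootArray i j m z j k = kiteQ m z := by
  simp [rootArray, kiteArray, hij.symm, hik.symm, hjk]

section Realizes

variable {x y : Fin 4 → EuclideanSpace ℝ (Fin 2)} {s : Fin 4 → Fin 4 → ℝ}

theorem Realizes.diag (hx : Realizes x s) (i : Fin 4) : s i i = 0 := by rw [hx]; simp

theorem Realizes.symm (hx : Realizes x s) (i j : Fin 4) : s i j = s j i := by
  rw [hx, hx, dist_comm]

theorem Realizes.injective (hx : Realizes x s) (hs : ∀ i j, i ≠ j → 0 < s i j) :
    Function.Injective x := by
  intro i j h
  by_contra hij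
  have := hs i j hij
  rw [hx, h, dist_self] at this
  simp at this

theorem Realizes.isRhombus (hx : Realizes x s) (hy : Realizes y s) (h : IsRhombus x) :
    IsRhombus y := by
  have hd : ∀ i j, dist (x i) (x j) = dist (y i) (y j) := fun i j =>
    (sq_eq_sq₀ dist_nonneg dist_nonneg).1 ((hx i j).symm.trans (hy i j))
  obtain ⟨hinj, i, j, k, l, hn, h1, h2, h3⟩ := h
  simp only [hd] at h1 h2 h3
  refine ⟨fun a b hab => hinj ?_, i, j, k, l, hn, h1, h2, h3⟩
  rw [← dist_eq_zero, hd, hab, dist_self]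

end Realizes

theorem IsKiteWithAxis.exists_frame {x : Fin 4 → EuclideanSpace ℝ (Fin 2)} {i j k l : Fin 4}
    (hx : IsKiteWithAxis x i j) (hn : [i, j, k, l].Nodup) :
    ∃ o₀ o₁ n₀ n₁ u v h, KiteFrame x i j k l o₀ o₁ n₀ n₁ u v h := by
  obtain ⟨hinj, k', l', hn', hi, hj⟩ := hx
  rw [AffineSubspace.mem_perpBisector_iff_dist_eq] at hi hj
  obtain ⟨h1, h2, h3, h4, h5, h6⟩ := nodup_four_iff.1 hn
  obtain ⟨g1, g2, g3, g4, g5, g6⟩ := nodup_four_iff.1 hn'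
  have : dist (x i) (x k) = dist (x i) (x l) ∧ dist (x j) (x k) = dist (x j) (x l) := by
    rcases eq_or_of_nodup_four hn' k with rfl | rfl | rfl | rfl <;>
    rcases eq_or_of_nodup_four hn' l with rfl | rfl | rfl | rfl <;>
    first
    | exact absurd rfl ‹_›
    | exact ⟨hi, hj⟩
    | exact ⟨hi.symm, hj.symm⟩
  exact exists_kiteFrame (fun h => h6 (hinj h)) (by rw [this.1]) (by rw [this.2])

theorem IsKiteWithAxis.symm {x : Fin 4 → EuclideanSpace ℝ (Fin 2)} {i j : Fin 4}
    (hx : IsKiteWithAxis x i j) : IsKiteWithAxis x j i := by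
  obtain ⟨hinj, k, l, hn, hi, hj⟩ := hx
  exact ⟨hinj, k, l, (List.Perm.swap _ _ _).nodup_iff.1 hn, hj, hi⟩

theorem KiteFrame.isKiteWithAxis {x : Fin 4 → EuclideanSpace ℝ (Fin 2)} {i j k l : Fin 4}
    {o₀ o₁ n₀ n₁ u v h : ℝ} (F : KiteFrame x i j k l o₀ o₁ n₀ n₁ u v h)
    (hn : [i, j, k, l].Nodup) (hinj : Function.Injective x) : IsKiteWithAxis x i j := by
  refine ⟨hinj, k, l, hn, ?_, ?_⟩ <;> rw [AffineSubspace.mem_perpBisector_iff_dist_eq] <;>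
    refine (sq_eq_sq₀ dist_nonneg dist_nonneg).1 ?_
  · rw [F.dist_ik, F.dist_il]
  · rw [F.dist_jk, F.dist_jl]

/-- The array alone fixes uv = w - b/4 in every realization, since p + q = a + 2w; hence convexity
type does not depend on the chosen points. -/
theorem exists_frame_of_mem_axisSolutions {i j k l : Fin 4} (hn : [i, j, k, l].Nodup) {m : ℝ}
    {s : Fin 4 → Fin 4 → ℝ} (hs : s ∈ axisSolutions i j m)
    {x : Fin 4 → EuclideanSpace ℝ (Fin 2)} (hx : Realizes x s) :
    ∃ z ∈ kiteRoots m, ∃ o₀ o₁ n₀ n₁ u v h, KiteFrame x i j k l o₀ o₁ n₀ n₁ u v h ∧ u ≠ v ∧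
      u * v = kiteW z - kiteB m z / 4 := by
  obtain ⟨h1, h2, h3, h4, h5, h6⟩ := nodup_four_iff.1 hn
  have hn' : [j, i, k, l].Nodup := (List.Perm.swap _ _ _).nodup_iff.1 hn
  obtain ⟨z, hz, hs⟩ := hs
  have key : s k l = kiteB m z ∧ s i j = kiteA m z ∧ s i k = s i l ∧ s j k = s j l ∧
      s i k + s j k = kiteA m z + 2 * kiteW z := by
    have hpq := kiteP_add_kiteQ m z
    rcases hs with rfl | rfl
    · rw [rootArray_kl hn, rootArray_ij h1, rootArray_ik h2 h4, rootArray_ik h3 h5,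
        rootArray_jk h1 h2 h4, rootArray_jk h1 h3 h5]
      exact ⟨rfl, rfl, rfl, rfl, hpq⟩
    · rw [hx.symm i j, rootArray_kl hn', rootArray_ij h1.symm, rootArray_ik h4 h2,
        rootArray_ik h5 h3, rootArray_jk h1.symm h4 h2, rootArray_jk h1.symm h5 h3]
      exact ⟨rfl, rfl, rfl, rfl, by linarith⟩
  obtain ⟨e1, e2, e3, e4, e5⟩ := key
  have ha := kiteA_pos hz
  have hb := hz.2.2.1
  rw [hx] at e1 e2
  rw [hx, hx] at e3 e4 e5
  obtain ⟨o₀, o₁, n₀, n₁, u, v, h, F⟩ := exists_kiteFrame (i := i) (j := j)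
    (by intro h; rw [h, dist_self] at e1; norm_num at e1; linarith) e3 e4
  refine ⟨z, hz, o₀, o₁, n₀, n₁, u, v, h, F, ?_, ?_⟩
  · rintro rfl; rw [F.dist_ij, sub_self] at e2; norm_num at e2; linarith
  · rw [F.dist_kl] at e1; rw [F.dist_ij] at e2; rw [F.dist_ik, F.dist_jk] at e5
    linear_combination e5 / 2 - e2 / 2 - e1 / 4

theorem isConcaveConfig_of_mem_axisSolutions {i j k l : Fin 4} (hn : [i, j, k, l].Nodup) {m : ℝ}
    (hm : ∀ z ∈ kiteRoots m, kiteB m z < 4 * kiteW z)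
    {s : Fin 4 → Fin 4 → ℝ} (hs : s ∈ axisSolutions i j m)
    {x : Fin 4 → EuclideanSpace ℝ (Fin 2)} (hx : Realizes x s) : IsConcaveConfig x := by
  obtain ⟨z, hz, _, _, _, _, u, v, h, F, hne, huv⟩ := exists_frame_of_mem_axisSolutions hn hs hx
  exact F.isConcaveConfig hn hne (by linarith [hm z hz])

theorem isConvexConfig_of_mem_axisSolutions {i j k l : Fin 4} (hn : [i, j, k, l].Nodup) {m : ℝ}
    (hm : ∀ z ∈ kiteRoots m, 4 * kiteW z < kiteB m z)
    {s : Fin 4 → Fin 4 → ℝ} (hs : s ∈ axisSolutions i j m)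
    {x : Fin 4 → EuclideanSpace ℝ (Fin 2)} (hx : Realizes x s) : IsConvexConfig x := by
  obtain ⟨z, hz, _, _, _, _, u, v, h, F, hne, huv⟩ := exists_frame_of_mem_axisSolutions hn hs hx
  exact F.isConvexConfig hn (by linarith [hm z hz])

/-! ### The system in kite coordinates. -/

theorem unsymAlbouyChenciner_eq {i j k l : Fin 4} (hn : [i, j, k, l].Nodup) (m lam : ℝ)
    {s : Fin 4 → Fin 4 → ℝ} (hd : ∀ r, s r r = 0) :
    unsymAlbouyChenciner m lam s i j =
      vortexStrength m j * ((s i j)⁻¹ + lam) * (-(2 * s i j)) +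
      vortexStrength m k * ((s i k)⁻¹ + lam) * (s j k - s i k - s i j) +
      vortexStrength m l * ((s i l)⁻¹ + lam) * (s j l - s i l - s i j) := by
  obtain ⟨h1, h2, h3, h4, h5, h6⟩ := nodup_four_iff.1 hn
  rw [unsymAlbouyChenciner, sum_eq_of_nodup_four hn]
  simp only [coeffS, if_true, if_neg h1, if_neg h2, if_neg h3, hd]
  ring

theorem albouyChenciner_eq_add {m lam : ℝ} {s : Fin 4 → Fin 4 → ℝ} (hs : ∀ r t, s r t = s t r)
    (i j : Fin 4) : albouyChenciner m lam s i j =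
      unsymAlbouyChenciner m lam s i j + unsymAlbouyChenciner m lam s j i := by
  rw [albouyChenciner, unsymAlbouyChenciner, unsymAlbouyChenciner, ← Finset.sum_add_distrib]
  refine Finset.sum_congr rfl fun k _ => ?_
  rw [hs j i]; ring

theorem vortexStrength_eq_or (m : ℝ) (r : Fin 4) :
    vortexStrength m r = 1 ∨ vortexStrength m r = m := by
  fin_cases r <;> simp [vortexStrength]

theorem vortexStrength_ne_zero {m : ℝ} (hm : m ≠ 0) (r : Fin 4) : vortexStrength m r ≠ 0 := by
  rcases vortexStrength_eq_or m r with h | h <;> rw [h]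
  · exact one_ne_zero
  · exact hm

/-- The total strength replaces an enumeration of labellings: it determines which strengths remain
once some are known. -/
theorem vortexStrength_add {i j k l : Fin 4} (hn : [i, j, k, l].Nodup) (m : ℝ) :
    vortexStrength m i + vortexStrength m j + vortexStrength m k + vortexStrength m l =
      2 + 2 * m := by
  rw [← sum_eq_of_nodup_four hn, Fin.sum_univ_four]
  simp [vortexStrength]; ring

theorem vortexStrength_axis_eq {i j k l : Fin 4} (hn : [i, j, k, l].Nodup) {m : ℝ}
    (h : vortexStrength m k = vortexStrength m l) :
    vortexStrength m i = vortexStrength m j := by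
  have hs := vortexStrength_add hn m
  rcases vortexStrength_eq_or m i with hi | hi <;> rcases vortexStrength_eq_or m j with hj | hj <;>
  rcases vortexStrength_eq_or m k with hk | hk <;> rw [← h, hk, hi, hj] at hs <;>
  rw [hi, hj] <;> linarith

theorem vortexStrength_ratio {i j k l : Fin 4} (hn : [i, j, k, l].Nodup) {m : ℝ}
    (hi : vortexStrength m i = vortexStrength m j)
    (hk : vortexStrength m k = vortexStrength m l) :
    vortexStrength m i = 1 ∧ vortexStrength m k = m ∨
      vortexStrength m i = m ∧ vortexStrength m k = 1 := by
  have hs := vortexStrength_add hn m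
  rw [← hi, ← hk] at hs
  rcases vortexStrength_eq_or m i with h | h <;> rw [h] at hs ⊢
  · left; exact ⟨rfl, by linarith⟩
  · right; exact ⟨rfl, by linarith⟩

section Solutions

variable {x : Fin 4 → EuclideanSpace ℝ (Fin 2)} {s : Fin 4 → Fin 4 → ℝ} {i j k l : Fin 4}
  {o₀ o₁ n₀ n₁ u v h m lam : ℝ}

/-- The unsymmetrized equations for pairs starting at `i` or `k`, in coordinates. -/
theorem KiteFrame.unsym_formulas (F : KiteFrame x i j k l o₀ o₁ n₀ n₁ u v h) (hx : Realizes x s)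
    (hn : [i, j, k, l].Nodup) (m lam : ℝ) {A B P Q : ℝ} (hA : ((u - v) ^ 2)⁻¹ + lam = A)
    (hB : (4 * h ^ 2)⁻¹ + lam = B) (hP : (u ^ 2 + h ^ 2)⁻¹ + lam = P)
    (hQ : (v ^ 2 + h ^ 2)⁻¹ + lam = Q) :
    unsymAlbouyChenciner m lam s i j = -2 * vortexStrength m j * A * (u - v) ^ 2 -
        2 * (vortexStrength m k + vortexStrength m l) * P * u * (u - v) ∧
      unsymAlbouyChenciner m lam s i k = -2 * vortexStrength m k * P * (u ^ 2 + h ^ 2) -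
        2 * vortexStrength m j * A * u * (u - v) +
          2 * vortexStrength m l * P * (h ^ 2 - u ^ 2) ∧
      unsymAlbouyChenciner m lam s k i = -2 * vortexStrength m i * P * (u ^ 2 + h ^ 2) -
        2 * vortexStrength m j * Q * (u * v + h ^ 2) - 4 * vortexStrength m l * B * h ^ 2 ∧
      unsymAlbouyChenciner m lam s k l = -4 * h ^ 2 * (vortexStrength m i * P +
        vortexStrength m j * Q + 2 * vortexStrength m l * B) := by
  obtain ⟨h1, h2, h3, h4, h5, h6⟩ := nodup_four_iff.1 hn
  have p1 : [i, k, j, l].Nodup :=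
    nodup_four_iff.2 ⟨h2, h1, h3, h4.symm, h6, h5⟩
  have p2 : [k, i, j, l].Nodup :=
    nodup_four_iff.2 ⟨h2.symm, h4.symm, h6, h1, h3, h5⟩
  have p3 : [k, l, i, j].Nodup :=
    nodup_four_iff.2 ⟨h6, h2.symm, h4.symm, h3.symm, h5.symm, h1⟩
  have d1 : s i j = (u - v) ^ 2 := by rw [hx, F.dist_ij]
  have d2 : s k l = 4 * h ^ 2 := by rw [hx, F.dist_kl]
  have d3 : s i k = u ^ 2 + h ^ 2 := by rw [hx, F.dist_ik]
  have d4 : s i l = u ^ 2 + h ^ 2 := by rw [hx, F.dist_il]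
  have d5 : s j k = v ^ 2 + h ^ 2 := by rw [hx, F.dist_jk]
  have d6 : s j l = v ^ 2 + h ^ 2 := by rw [hx, F.dist_jl]
  rw [unsymAlbouyChenciner_eq hn _ _ hx.diag, unsymAlbouyChenciner_eq p1 _ _ hx.diag,
    unsymAlbouyChenciner_eq p2 _ _ hx.diag, unsymAlbouyChenciner_eq p3 _ _ hx.diag,
    hx.symm k i, hx.symm k j, hx.symm l i, hx.symm l j, d1, d2, d3, d4, d5, d6, hA, hB, hP, hQ]
  refine ⟨?_, ?_, ?_, ?_⟩ <;> ring

theorem KiteFrame.equations_of_isPositiveSolution (F : KiteFrame x i j k l o₀ o₁ n₀ n₁ u v h)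
    (hn : [i, j, k, l].Nodup) (hx : Realizes x s) (hs : IsPositiveSolution m lam s) (hm : m ≠ 0)
    (hne : u ≠ v) (hsum : u + v ≠ 0) :
    vortexStrength m k = vortexStrength m l ∧ vortexStrength m i = vortexStrength m j ∧
      (((u - v) ^ 2)⁻¹ + lam) * (v - u) =
        2 * (vortexStrength m k / vortexStrength m i) * u * ((u ^ 2 + h ^ 2)⁻¹ + lam) ∧
      (((u - v) ^ 2)⁻¹ + lam) * (u - v) =
        2 * (vortexStrength m k / vortexStrength m i) * v * ((v ^ 2 + h ^ 2)⁻¹ + lam) ∧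
      ((u ^ 2 + h ^ 2)⁻¹ + lam) + ((v ^ 2 + h ^ 2)⁻¹ + lam) +
        2 * (vortexStrength m k / vortexStrength m i) * ((4 * h ^ 2)⁻¹ + lam) = 0 := by
  obtain ⟨h1, h2, h3, h4, h5, h6⟩ := nodup_four_iff.1 hn
  have hn1 : [j, i, k, l].Nodup := (List.Perm.swap _ _ _).nodup_iff.1 hn
  have hn2 : [i, j, l, k].Nodup := (((List.Perm.swap _ _ _).cons _).cons _).nodup_iff.1 hn
  have hn3 : [j, i, l, k].Nodup := (List.Perm.swap _ _ _).nodup_iff.1 hn2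
  obtain ⟨a1, a2, -, a4⟩ := F.unsym_formulas hx hn m lam rfl rfl rfl rfl
  obtain ⟨b1, b2, -, -⟩ := F.swap_axis.unsym_formulas hx hn1 m lam rfl rfl rfl rfl
  obtain ⟨-, c2, -, -⟩ := F.swap_sides.unsym_formulas hx hn2 m lam rfl rfl rfl rfl
  obtain ⟨-, d2, -, -⟩ := F.swap_axis.swap_sides.unsym_formulas hx hn3 m lam rfl rfl rfl rfl
  have e1 : -u - -v = -(u - v) := by ring
  have e2 : -v - -u = -(v - u) := by ring
  rw [hs.unsym_eq _ _ h1] at a1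
  rw [hs.unsym_eq _ _ h2] at a2
  rw [hs.unsym_eq _ _ h6] at a4
  rw [hs.unsym_eq _ _ h1.symm] at b1
  rw [hs.unsym_eq _ _ h4] at b2
  rw [hs.unsym_eq _ _ h3, e1, neg_sq, neg_sq] at c2
  rw [hs.unsym_eq _ _ h5, e2, neg_sq, neg_sq] at d2
  have hh := F.pos
  have hd : u - v ≠ 0 := sub_ne_zero.2 hne
  -- Comparing the equations at `(i, k)` and `(i, l)`, and likewise at `j`, unequal strengths would
  -- make both side coefficients vanish, hence u² = v².
  have hkl : vortexStrength m k = vortexStrength m l := by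
    by_contra hkl
    have hkl := sub_ne_zero.2 hkl
    have hP : 4 * h ^ 2 * (vortexStrength m k - vortexStrength m l) *
        ((u ^ 2 + h ^ 2)⁻¹ + lam) = 0 := by linear_combination a2 - c2
    have hQ : 4 * h ^ 2 * (vortexStrength m k - vortexStrength m l) *
        ((v ^ 2 + h ^ 2)⁻¹ + lam) = 0 := by linear_combination b2 - d2
    have hP := (mul_eq_zero.1 hP).resolve_left (by positivity)
    have hQ := (mul_eq_zero.1 hQ).resolve_left (by positivity)
    have := inv_injective (add_right_cancel (hP.trans hQ.symm))
    have : (u - v) * (u + v) = 0 := by linear_combination this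
    exact (mul_ne_zero hd hsum) this
  have hij := vortexStrength_axis_eq hn hkl
  have hi0 := vortexStrength_ne_zero hm i
  have hμ : vortexStrength m k = vortexStrength m k / vortexStrength m i * vortexStrength m i :=
    (div_mul_cancel₀ _ hi0).symm
  refine ⟨hkl, hij, ?_⟩
  rw [← hkl, ← hij] at a1 a4
  rw [← hkl] at b1
  generalize vortexStrength m k / vortexStrength m i = μ at *
  rw [hμ] at a1 a4 b1
  refine ⟨?_, ?_, ?_⟩
  · refine mul_left_cancel₀ (mul_ne_zero (mul_ne_zero two_ne_zero hi0) hd) ?_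
    linear_combination -a1
  · refine mul_left_cancel₀ (mul_ne_zero (mul_ne_zero two_ne_zero hi0) hd) ?_
    linear_combination b1
  · refine mul_left_cancel₀ (show -4 * h ^ 2 * vortexStrength m i ≠ 0 by
      refine mul_ne_zero (mul_ne_zero (by norm_num) (by positivity)) hi0) ?_
    linear_combination -a4

/-- Every non-rhombic kite solution comes, after rescaling, from an admissible root. -/
theorem scaled_mem_axisSolutions (hm : m ≠ 0) (hlam : lam < 0) (hs : IsPositiveSolution m lam s)
    (hx : Realizes x s) (hkite : IsKiteWithAxis x i j) (hr : ¬ IsRhombus x)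
    (hn : [i, j, k, l].Nodup) :
    vortexStrength m k = vortexStrength m l ∧ vortexStrength m i = vortexStrength m j ∧
      (fun r t => -lam * s r t) ∈
        axisSolutions i j (vortexStrength m k / vortexStrength m i) := by
  obtain ⟨o₀, o₁, n₀, n₁, u, v, h, F⟩ := hkite.exists_frame hn
  rw [F.isRhombus_iff hn hkite.1] at hr
  have hne : u ≠ v := by
    rintro rfl
    have h1 := hs.pos i j (nodup_four_iff.1 hn).1
    rw [hx, F.dist_ij, sub_self] at h1
    norm_num at h1
  obtain ⟨hkl, hij, e1, e2, e3⟩ := F.equations_of_isPositiveSolution hn hx hs hm hne hr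
  refine ⟨hkl, hij, ?_⟩
  have hμ : vortexStrength m k / vortexStrength m i ≠ 0 :=
    div_ne_zero (vortexStrength_ne_zero hm k) (vortexStrength_ne_zero hm i)
  generalize vortexStrength m k / vortexStrength m i = μ at *
  -- Dilating lengths by c = √(-λ') normalizes the multiplier to -1.
  obtain ⟨c, hc, rfl⟩ : ∃ c : ℝ, 0 < c ∧ lam = -c ^ 2 :=
    ⟨√(-lam), Real.sqrt_pos.2 (by linarith), by rw [Real.sq_sqrt (by linarith)]; ring⟩
  have hscale : ∀ t : ℝ, (c ^ 2 * t)⁻¹ - 1 = (c ^ 2)⁻¹ * (t⁻¹ + -c ^ 2) := fun t => by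
    rw [mul_inv, mul_add, mul_neg, inv_mul_cancel₀ (by positivity)]; ring
  have g1 : (c * u - c * v) ^ 2 = c ^ 2 * (u - v) ^ 2 := by ring
  have g2 : (c * u) ^ 2 + (c * h) ^ 2 = c ^ 2 * (u ^ 2 + h ^ 2) := by ring
  have g3 : (c * v) ^ 2 + (c * h) ^ 2 = c ^ 2 * (v ^ 2 + h ^ 2) := by ring
  have g4 : 4 * (c * h) ^ 2 = c ^ 2 * (4 * h ^ 2) := by ring
  have E : KiteEquations μ (c * u) (c * v) (c * h) := by
    refine ⟨?_, ?_, ?_⟩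
    · rw [g1, g2, hscale, hscale]; linear_combination (c ^ 2)⁻¹ * c * e1
    · rw [g1, g3, hscale, hscale]; linear_combination (c ^ 2)⁻¹ * c * e2
    · rw [g2, g3, g4, hscale, hscale, hscale]; linear_combination (c ^ 2)⁻¹ * e3
  obtain ⟨z, hz, hA, hB, hW⟩ := E.exists_root hμ (mul_pos hc F.pos)
    (fun h0 => hne (mul_left_cancel₀ hc.ne' h0)) (by rw [← mul_add]; exact mul_ne_zero hc.ne' hr)
  have hsq : kiteA μ z * (kiteA μ z + 4 * kiteW z - kiteB μ z) =
      ((c * u) ^ 2 - (c * v) ^ 2) ^ 2 := by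
    rw [← hA, ← hB, ← hW]; ring
  have hroot : √(kiteA μ z * (kiteA μ z + 4 * kiteW z - kiteB μ z)) =
      |(c * u) ^ 2 - (c * v) ^ 2| := by rw [hsq, Real.sqrt_sq_eq_abs]
  have hdiag : ∀ r, - -c ^ 2 * s r r = 0 := fun r => by rw [hx.diag, mul_zero]
  have hsymm : ∀ r t, - -c ^ 2 * s r t = - -c ^ 2 * s t r := fun r t => by rw [hx.symm]
  have hn1 : [j, i, k, l].Nodup := (List.Perm.swap _ _ _).nodup_iff.1 hn
  refine ⟨z, hz, ?_⟩
  -- The larger of |u| and |v| decides which axis end carries `kiteP`.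
  rcases le_total ((c * v) ^ 2) ((c * u) ^ 2) with hle | hle
  · have hP : kiteP μ z = c ^ 2 * (u ^ 2 + h ^ 2) := by
      rw [kiteP, hroot, abs_of_nonneg (by linarith), ← hA, ← hW]; ring
    have hQ : kiteQ μ z = c ^ 2 * (v ^ 2 + h ^ 2) := by
      rw [kiteQ, hroot, abs_of_nonneg (by linarith), ← hA, ← hW]; ring
    left
    refine kiteArray_eq hn hdiag hsymm ?_ ?_ ?_ ?_ ?_ ?_ <;> rw [hx, neg_neg]
    · rw [F.dist_ij, ← hA, g1]
    · rw [F.dist_kl, ← hB, g4]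
    · rw [F.dist_ik, hP]
    · rw [F.dist_il, hP]
    · rw [F.dist_jk, hQ]
    · rw [F.dist_jl, hQ]
  · have hP : kiteP μ z = c ^ 2 * (v ^ 2 + h ^ 2) := by
      rw [kiteP, hroot, abs_of_nonpos (by linarith), ← hA, ← hW]; ring
    have hQ : kiteQ μ z = c ^ 2 * (u ^ 2 + h ^ 2) := by
      rw [kiteQ, hroot, abs_of_nonpos (by linarith), ← hA, ← hW]; ring
    right
    refine kiteArray_eq hn1 hdiag hsymm ?_ ?_ ?_ ?_ ?_ ?_ <;> rw [hx, neg_neg]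
    · rw [F.swap_axis.dist_ij, ← hA]; ring
    · rw [F.dist_kl, ← hB, g4]
    · rw [F.dist_jk, hP]
    · rw [F.dist_jl, hP]
    · rw [F.dist_ik, hQ]
    · rw [F.dist_il, hQ]

theorem KiteEquations.swap {μ : ℝ} (E : KiteEquations μ u v h) : KiteEquations μ v u h := by
  have e : (v - u) ^ 2 = (u - v) ^ 2 := by ring
  exact ⟨e ▸ E.axis_right, e ▸ E.axis_left, by linear_combination E.cross⟩

theorem KiteEquations.neg {μ : ℝ} (E : KiteEquations μ u v h) : KiteEquations μ (-u) (-v) h := by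
  have e : (-u - -v) ^ 2 = (u - v) ^ 2 := by ring
  refine ⟨?_, ?_, ?_⟩
  · rw [e, neg_sq]; linear_combination -E.axis_left
  · rw [e, neg_sq]; linear_combination -E.axis_right
  · rw [neg_sq, neg_sq]; exact E.cross

theorem KiteFrame.unsym_eq_zero (F : KiteFrame x i j k l o₀ o₁ n₀ n₁ u v h) (hx : Realizes x s)
    (hn : [i, j, k, l].Nodup) (hm : m ≠ 0)
    (hij : vortexStrength m i = vortexStrength m j)
    (hkl : vortexStrength m k = vortexStrength m l)
    (E : KiteEquations (vortexStrength m k / vortexStrength m i) u v h) :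
    unsymAlbouyChenciner m (-1) s i j = 0 ∧ unsymAlbouyChenciner m (-1) s i k = 0 ∧
      unsymAlbouyChenciner m (-1) s k i = 0 ∧ unsymAlbouyChenciner m (-1) s k l = 0 := by
  obtain ⟨a1, a2, a3, a4⟩ := F.unsym_formulas hx hn m (-1) rfl rfl rfl rfl
  have hi0 := vortexStrength_ne_zero hm i
  have hμ0 : vortexStrength m k / vortexStrength m i ≠ 0 :=
    div_ne_zero (vortexStrength_ne_zero hm k) hi0
  have hμ : vortexStrength m k = vortexStrength m k / vortexStrength m i * vortexStrength m i :=
    (div_mul_cancel₀ _ hi0).symm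
  rw [a1, a2, a3, a4, ← hij, ← hkl]
  generalize vortexStrength m k / vortexStrength m i = μ at *
  rw [hμ]
  obtain ⟨E1, E2, E3⟩ := E
  have E4 : u * ((u ^ 2 + h ^ 2)⁻¹ + -1) + v * ((v ^ 2 + h ^ 2)⁻¹ + -1) = 0 := by
    refine mul_left_cancel₀ (mul_ne_zero two_ne_zero hμ0) ?_
    linear_combination -E1 - E2
  refine ⟨?_, ?_, ?_, ?_⟩
  · linear_combination 2 * vortexStrength m i * (u - v) * E1
  · linear_combination 2 * vortexStrength m i * u * E1
  · linear_combination -2 * vortexStrength m i * (u * E4 + h ^ 2 * E3)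
  · linear_combination -4 * h ^ 2 * vortexStrength m i * E3

theorem KiteFrame.dziobek_eq_zero (F : KiteFrame x i j k l o₀ o₁ n₀ n₁ u v h) (hx : Realizes x s)
    (hn : [i, j, k, l].Nodup) {μ : ℝ} (hμ : μ ≠ 0) (hne : u ≠ v) (E : KiteEquations μ u v h)
    (i' j' k' l' : Fin 4) (hn' : [i', j', k', l'].Nodup) : dziobek (-1) s i' j' k' l' = 0 := by
  obtain ⟨E1, E2, E3⟩ := E
  have E4 : u * ((u ^ 2 + h ^ 2)⁻¹ + -1) + v * ((v ^ 2 + h ^ 2)⁻¹ + -1) = 0 := by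
    refine mul_left_cancel₀ (mul_ne_zero two_ne_zero hμ) ?_
    linear_combination -E1 - E2
  -- The only nontrivial Dziobek relation for a kite; the others compare equal products. It follows
  -- by eliminating μ between the axis and cross equations.
  have key : (((u - v) ^ 2)⁻¹ + -1) * ((4 * h ^ 2)⁻¹ + -1) =
      ((u ^ 2 + h ^ 2)⁻¹ + -1) * ((v ^ 2 + h ^ 2)⁻¹ + -1) := by
    refine mul_left_cancel₀ (sub_ne_zero.2 hne.symm) ?_
    linear_combination ((4 * h ^ 2)⁻¹ + -1) * E1 + u * ((u ^ 2 + h ^ 2)⁻¹ + -1) * E3 -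
      ((u ^ 2 + h ^ 2)⁻¹ + -1) * E4
  obtain ⟨h1, h2, h3, h4, h5, h6⟩ := nodup_four_iff.1 hn
  obtain ⟨g1, g2, g3, g4, g5, g6⟩ := nodup_four_iff.1 hn'
  have d1 : s i j = (u - v) ^ 2 := by rw [hx, F.dist_ij]
  have d2 : s k l = 4 * h ^ 2 := by rw [hx, F.dist_kl]
  have d3 : s i k = u ^ 2 + h ^ 2 := by rw [hx, F.dist_ik]
  have d4 : s i l = u ^ 2 + h ^ 2 := by rw [hx, F.dist_il]
  have d5 : s j k = v ^ 2 + h ^ 2 := by rw [hx, F.dist_jk]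
  have d6 : s j l = v ^ 2 + h ^ 2 := by rw [hx, F.dist_jl]
  have b1 := (hx.symm j i).trans d1
  have b2 := (hx.symm l k).trans d2
  have b3 := (hx.symm k i).trans d3
  have b4 := (hx.symm l i).trans d4
  have b5 := (hx.symm k j).trans d5
  have b6 := (hx.symm l j).trans d6
  unfold dziobek
  rcases eq_or_of_nodup_four hn i' with rfl | rfl | rfl | rfl <;>
  rcases eq_or_of_nodup_four hn j' with rfl | rfl | rfl | rfl <;>
  first
  | exact absurd rfl g1
  | (rcases eq_or_of_nodup_four hn k' with rfl | rfl | rfl | rfl <;>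
    first
    | exact absurd rfl g2
    | exact absurd rfl g4
    | (rcases eq_or_of_nodup_four hn l' with rfl | rfl | rfl | rfl <;>
      first
      | exact absurd rfl g3
      | exact absurd rfl g5
      | exact absurd rfl g6
      | (simp only [d1, d2, d3, d4, d5, d6, b1, b2, b3, b4, b5, b6]
         first
         | linear_combination key
         | linear_combination -key
         | ring)))

/-- Every admissible root gives a non-rhombic kite solution. -/
theorem isPositiveSolution_rootArray (hm : m ≠ 0) (hn : [i, j, k, l].Nodup)
    (hij : vortexStrength m i = vortexStrength m j)
    (hkl : vortexStrength m k = vortexStrength m l) {z : ℝ}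
    (hz : z ∈ kiteRoots (vortexStrength m k / vortexStrength m i)) :
    IsPositiveSolution m (-1) (rootArray i j (vortexStrength m k / vortexStrength m i) z) ∧
      ∃ x, Realizes x (rootArray i j (vortexStrength m k / vortexStrength m i) z) ∧
        IsKiteWithAxis x i j ∧ ¬ IsRhombus x := by
  obtain ⟨h1, h2, h3, h4, h5, h6⟩ := nodup_four_iff.1 hn
  have hμ0 : vortexStrength m k / vortexStrength m i ≠ 0 :=
    div_ne_zero (vortexStrength_ne_zero hm k) (vortexStrength_ne_zero hm i)
  obtain ⟨u, v, h, hh, huv, hsum, E, hA, hB, hP, hQ⟩ := exists_kiteEquations hμ0 hz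
  let x : Fin 4 → EuclideanSpace ℝ (Fin 2) := fun r =>
    if r = i then !₂[0, u] else if r = j then !₂[0, v] else if r = k then !₂[-h, 0] else !₂[h, 0]
  have F : KiteFrame x i j k l 0 0 1 0 u v h := by
    constructor <;> simp [x, hh, h1.symm, h2.symm, h3.symm, h4.symm, h5.symm, h6.symm]
  have hx : Realizes x (rootArray i j (vortexStrength m k / vortexStrength m i) z) := by
    have : (fun r t => dist (x r) (x t) ^ 2) =
        rootArray i j (vortexStrength m k / vortexStrength m i) z := by
      refine kiteArray_eq hn (fun r => by simp) (fun r t => by rw [dist_comm]) ?_ ?_ ?_ ?_ ?_ ?_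
      · rw [F.dist_ij, hA]
      · rw [F.dist_kl, hB]
      · rw [F.dist_ik, hP]
      · rw [F.dist_il, hP]
      · rw [F.dist_jk, hQ]
      · rw [F.dist_jl, hQ]
    intro r t
    rw [← this]
  have hpos : ∀ r t, r ≠ t →
      0 < rootArray i j (vortexStrength m k / vortexStrength m i) z r t := by
    intro r t hrt
    have : 0 < u - v := by linarith
    simp only [rootArray, kiteArray, if_neg hrt, ← hA, ← hB, ← hP, ← hQ]
    split_ifs <;> positivity
  have hinj := hx.injective hpos
  have hn1 : [j, i, k, l].Nodup := (List.Perm.swap _ _ _).nodup_iff.1 hn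
  have hn2 : [i, j, l, k].Nodup := (((List.Perm.swap _ _ _).cons _).cons _).nodup_iff.1 hn
  have hn3 : [j, i, l, k].Nodup := (List.Perm.swap _ _ _).nodup_iff.1 hn2
  have hunsym : ∀ r t, r ≠ t → unsymAlbouyChenciner m (-1)
      (rootArray i j (vortexStrength m k / vortexStrength m i) z) r t = 0 := by
    have r1 : vortexStrength m k / vortexStrength m i =
      vortexStrength m k / vortexStrength m j := by rw [hij]
    have r2 : vortexStrength m k / vortexStrength m i =
      vortexStrength m l / vortexStrength m i := by rw [hkl]
    have r3 : vortexStrength m k / vortexStrength m i =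
      vortexStrength m l / vortexStrength m j := by rw [hij, hkl]
    obtain ⟨a1, a2, a3, a4⟩ := F.unsym_eq_zero hx hn hm hij hkl E
    obtain ⟨b1, b2, b3, b4⟩ := F.swap_axis.unsym_eq_zero hx hn1 hm hij.symm hkl (r1 ▸ E.swap)
    obtain ⟨c1, c2, c3, c4⟩ := F.swap_sides.unsym_eq_zero hx hn2 hm hij hkl.symm (r2 ▸ E.neg)
    obtain ⟨d1, d2, d3, d4⟩ :=
      F.swap_axis.swap_sides.unsym_eq_zero hx hn3 hm hij.symm hkl.symm (r3 ▸ E.swap.neg)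
    intro r t hrt
    rcases eq_or_of_nodup_four hn r with hr | hr | hr | hr <;>
    rcases eq_or_of_nodup_four hn t with ht | ht | ht | ht <;>
    first
    | exact absurd (hr.trans ht.symm) hrt
    | (rw [hr, ht]; assumption)
  refine ⟨⟨hx.diag, hx.symm, hpos, fun r t hrt => ?_, hunsym,
    cayleyMenger_eq_zero_of_realizes hx, F.dziobek_eq_zero hx hn hμ0 huv.ne' E⟩,
    x, hx, F.isKiteWithAxis hn hinj, ?_⟩
  · rw [albouyChenciner_eq_add hx.symm, hunsym _ _ hrt.ne, hunsym _ _ hrt.ne', add_zero]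
  · rw [F.isRhombus_iff hn hinj]; exact hsum.ne'

theorem exists_of_mem_axisSolutions (hm : m ≠ 0) (hn : [i, j, k, l].Nodup)
    (hij : vortexStrength m i = vortexStrength m j)
    (hkl : vortexStrength m k = vortexStrength m l)
    (hs : s ∈ axisSolutions i j (vortexStrength m k / vortexStrength m i)) :
    IsPositiveSolution m (-1) s ∧
      ∃ x, Realizes x s ∧ IsKiteWithAxis x i j ∧ ¬ IsRhombus x := by
  obtain ⟨z, hz, rfl | rfl⟩ := hs
  · exact isPositiveSolution_rootArray hm hn hij hkl hz
  · have hn1 : [j, i, k, l].Nodup := (List.Perm.swap _ _ _).nodup_iff.1 hn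
    rw [hij] at hz ⊢
    obtain ⟨h1, x, h2, h3, h4⟩ := isPositiveSolution_rootArray hm hn1 hij.symm hkl hz
    exact ⟨h1, x, h2, h3.symm, h4⟩

theorem mem_kiteSolutions_of_mem_axisSolutions (hm : m ≠ 0) (hn : [i, j, k, l].Nodup)
    (hij : vortexStrength m i = vortexStrength m j)
    (hkl : vortexStrength m k = vortexStrength m l)
    (hs : s ∈ axisSolutions i j (vortexStrength m k / vortexStrength m i)) :
    s ∈ kiteSolutions m (-1) := by
  obtain ⟨h1, x, h2, h3, h4⟩ := exists_of_mem_axisSolutions hm hn hij hkl hs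
  exact ⟨h1, x, h2, ⟨i, j, h3⟩, h4⟩

theorem mem_axisSolutions_of_realizes (hm : m ≠ 0) (hs : s ∈ kiteSolutions m (-1))
    (hx : Realizes x s) (hkite : IsKiteWithAxis x i j) (hn : [i, j, k, l].Nodup) :
    vortexStrength m k = vortexStrength m l ∧ vortexStrength m i = vortexStrength m j ∧
      s ∈ axisSolutions i j (vortexStrength m k / vortexStrength m i) := by
  obtain ⟨hsol, y, hy, -, hr⟩ := hs
  simpa using scaled_mem_axisSolutions hm (by norm_num) hsol hx hkite
    (fun h => hr (hx.isRhombus hy h)) hn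

theorem exists_mem_axisSolutions (hm : m ≠ 0) (hs : s ∈ kiteSolutions m (-1)) :
    ∃ i j k l, [i, j, k, l].Nodup ∧ vortexStrength m k = vortexStrength m l ∧
      vortexStrength m i = vortexStrength m j ∧
      s ∈ axisSolutions i j (vortexStrength m k / vortexStrength m i) := by
  obtain ⟨-, x, hx, ⟨i, j, hk⟩, -⟩ := id hs
  obtain ⟨-, k, l, hn, -⟩ := id hk
  exact ⟨i, j, k, l, hn, mem_axisSolutions_of_realizes hm hs hx hk hn⟩

theorem concaveKiteSolutions_eq (hm : m ≠ 0) (hn : [i, j, k, l].Nodup)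
    (hij : vortexStrength m i = vortexStrength m j)
    (hkl : vortexStrength m k = vortexStrength m l)
    (hz : ∀ z ∈ kiteRoots (vortexStrength m k / vortexStrength m i),
      kiteB (vortexStrength m k / vortexStrength m i) z < 4 * kiteW z) :
    concaveKiteSolutions m (-1) i j =
      axisSolutions i j (vortexStrength m k / vortexStrength m i) := by
  ext s
  constructor
  · rintro ⟨hs, x, hx, hk, -⟩
    exact (mem_axisSolutions_of_realizes hm hs hx hk hn).2.2
  · intro hs
    obtain ⟨-, x, hx, hk, -⟩ := exists_of_mem_axisSolutions hm hn hij hkl hs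
    exact ⟨mem_kiteSolutions_of_mem_axisSolutions hm hn hij hkl hs, x, hx, hk,
      isConcaveConfig_of_mem_axisSolutions hn hz hs hx⟩

theorem convexKiteSolutions_eq (hm : m ≠ 0) (hn : [i, j, k, l].Nodup)
    (hij : vortexStrength m i = vortexStrength m j)
    (hkl : vortexStrength m k = vortexStrength m l)
    (hz : ∀ z ∈ kiteRoots (vortexStrength m k / vortexStrength m i),
      4 * kiteW z < kiteB (vortexStrength m k / vortexStrength m i) z) :
    convexKiteSolutions m (-1) i j =
      axisSolutions i j (vortexStrength m k / vortexStrength m i) := by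
  ext s
  constructor
  · rintro ⟨hs, x, hx, hk, -⟩
    exact (mem_axisSolutions_of_realizes hm hs hx hk hn).2.2
  · intro hs
    obtain ⟨-, x, hx, hk, -⟩ := exists_of_mem_axisSolutions hm hn hij hkl hs
    exact ⟨mem_kiteSolutions_of_mem_axisSolutions hm hn hij hkl hs, x, hx, hk,
      isConvexConfig_of_mem_axisSolutions hn hz hs hx⟩

end Solutions

/-! ### Counting the solutions. -/

/-- Equal strengths on the axis leave only the pairs {0, 1} and {2, 3} when m ≠ 1; at m = 1 any pair
can be an axis. -/
theorem kiteSolutions_eq_union {m : ℝ} (hm : m ≠ 0) (hm1 : m ≠ 1) :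
    kiteSolutions m (-1) = axisSolutions 0 1 m ∪ axisSolutions 2 3 m⁻¹ := by
  ext s
  constructor
  · intro hs
    obtain ⟨i, j, k, l, hn, hkl, hij, hs⟩ := exists_mem_axisSolutions hm hs
    have hne := (nodup_four_iff.1 hn).1
    have hpair : (i = 0 ∧ j = 1 ∨ i = 1 ∧ j = 0) ∧ vortexStrength m i = 1 ∨
        (i = 2 ∧ j = 3 ∨ i = 3 ∧ j = 2) ∧ vortexStrength m i = m := by
      fin_cases i <;> fin_cases j <;>
        simp_all [vortexStrength, eq_comm (a := (1 : ℝ)) (b := m)]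
    have hsum := vortexStrength_add hn m
    rw [← hij, ← hkl] at hsum
    rcases hpair with ⟨h, hi⟩ | ⟨h, hi⟩
    · rw [hi, show vortexStrength m k = m by linarith, div_one] at hs
      rcases h with ⟨rfl, rfl⟩ | ⟨rfl, rfl⟩
      · exact Or.inl hs
      · exact Or.inl (axisSolutions_comm _ _ _ ▸ hs)
    · rw [hi, show vortexStrength m k = 1 by linarith, one_div] at hs
      rcases h with ⟨rfl, rfl⟩ | ⟨rfl, rfl⟩
      · exact Or.inr hs
      · exact Or.inr (axisSolutions_comm _ _ _ ▸ hs)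
  · rintro (hs | hs)
    · exact mem_kiteSolutions_of_mem_axisSolutions (i := 0) (j := 1) (k := 2) (l := 3) hm
        (by decide) (by simp [vortexStrength]) (by simp [vortexStrength])
        (by simpa [vortexStrength] using hs)
    · exact mem_kiteSolutions_of_mem_axisSolutions (i := 2) (j := 3) (k := 0) (l := 1) hm
        (by decide) (by simp [vortexStrength]) (by simp [vortexStrength])
        (by simpa [vortexStrength] using hs)

theorem axisSolutions_eq_empty {i j : Fin 4} {m : ℝ} (h : kiteRoots m = ∅) :
    axisSolutions i j m = ∅ := by
  ext s; simp [axisSolutions, h]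

theorem axisSolutions_eq_pair {i j : Fin 4} {m z : ℝ} (h : kiteRoots m = {z}) :
    axisSolutions i j m = {rootArray i j m z, rootArray j i m z} := by
  ext s; simp [axisSolutions, h]

theorem rootArray_ne_swap {i j : Fin 4} (hij : i ≠ j) {m y z : ℝ} (hy : y ∈ kiteRoots m)
    (hz : z ∈ kiteRoots m) (hyz : y = z) : rootArray i j m y ≠ rootArray j i m z := by
  subst hyz
  obtain ⟨k, l, hn⟩ := exists_nodup_four hij
  obtain ⟨h1, h2, h3, h4, h5, h6⟩ := nodup_four_iff.1 hn
  intro h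
  have := congrFun (congrFun h i) k
  rw [rootArray_ik h2 h4, rootArray_jk h1.symm h4 h2] at this
  exact (kiteQ_lt_kiteP hy).ne' this

theorem ncard_pair_rootArray {i j : Fin 4} (hij : i ≠ j) {m z : ℝ} (hz : z ∈ kiteRoots m) :
    Set.ncard {rootArray i j m z, rootArray j i m z} = 2 :=
  Set.ncard_pair (rootArray_ne_swap hij hz hz rfl)

theorem ncard_axisSolutions_of_singleton {i j : Fin 4} (hij : i ≠ j) {m z : ℝ}
    (h : kiteRoots m = {z}) : (axisSolutions i j m).ncard = 2 := by
  rw [axisSolutions_eq_pair h]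
  exact ncard_pair_rootArray hij (by rw [h]; rfl)

theorem ncard_axisSolutions_of_pair {i j : Fin 4} (hij : i ≠ j) {m z₁ z₂ : ℝ} (hm : m ≠ 0)
    (hne : z₁ ≠ z₂) (h : kiteRoots m = {z₁, z₂}) : (axisSolutions i j m).ncard = 4 := by
  have hset : axisSolutions i j m = {rootArray i j m z₁, rootArray j i m z₁} ∪
      {rootArray i j m z₂, rootArray j i m z₂} := by
    ext s; simp [axisSolutions, h]; tauto
  obtain ⟨k, l, hn⟩ := exists_nodup_four hij
  have hn1 : [j, i, k, l].Nodup := (List.Perm.swap _ _ _).nodup_iff.1 hn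
  -- The off-axis distance b = 1 + z/m tells the two roots apart.
  have hB : ∀ z, ∀ s ∈ ({rootArray i j m z, rootArray j i m z} : Set (Fin 4 → Fin 4 → ℝ)),
      s k l = kiteB m z := by
    rintro z s (rfl | rfl)
    · exact rootArray_kl hn m z
    · exact rootArray_kl hn1 m z
  rw [hset, Set.ncard_union_eq, ncard_pair_rootArray hij (by rw [h]; simp),
    ncard_pair_rootArray hij (by rw [h]; simp)]
  refine Set.disjoint_left.2 fun s h1 h2 => hne ?_
  have := (hB _ s h1).symm.trans (hB _ s h2)
  unfold kiteB at this
  exact (div_left_inj' hm).1 (add_left_cancel this)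

/-- Symmetry about the axis through 2, 3 gives `s 0 2 = s 1 2`, whereas a strict kite on the axis
through 0, 1 has p ≠ q. -/
theorem disjoint_axisSolutions (m μ : ℝ) :
    Disjoint (axisSolutions 0 1 m) (axisSolutions 2 3 μ) := by
  refine Set.disjoint_left.2 ?_
  rintro s ⟨z, hz, h⟩ ⟨y, -, h'⟩
  have h1 : s 0 2 ≠ s 1 2 := by
    rcases h with rfl | rfl
    · rw [rootArray_ik (by decide) (by decide), rootArray_jk (by decide) (by decide) (by decide)]
      exact (kiteQ_lt_kiteP hz).ne'
    · rw [rootArray_ik (by decide) (by decide), rootArray_jk (by decide) (by decide) (by decide)]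
      exact (kiteQ_lt_kiteP hz).ne
  refine h1 ?_
  rcases h' with rfl | rfl <;> simp [rootArray, kiteArray]

/-- At the double root z = 1/2 one finds a = q = 1/2 and b = p = 3/2: an equilateral triangle with
the nearer axis end at its centre. Different axes share these arrays, so the count is over the four
choices of centre. -/
theorem kiteSolutions_one_ncard : (kiteSolutions 1 (-1)).ncard = 4 := by
  have hone : ∀ r, vortexStrength 1 r = 1 := fun r => by
    rcases vortexStrength_eq_or 1 r with h | h <;> exact h
  let star : Fin 4 → Fin 4 → Fin 4 → ℝ := fun j r t =>
    if r = t then 0 else if r = j ∨ t = j then 1 / 2 else 3 / 2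
  have hA : kiteA 1 (1 / 2) = 1 / 2 := by norm_num [kiteA, kiteB]
  have hB : kiteB 1 (1 / 2) = 3 / 2 := by norm_num [kiteB]
  have hW : kiteW (1 / 2) = 3 / 4 := by norm_num [kiteW]
  have hr : √(kiteA 1 (1 / 2) * (kiteA 1 (1 / 2) + 4 * kiteW (1 / 2) - kiteB 1 (1 / 2))) = 1 := by
    rw [hA, hB, hW]; norm_num
  have hP : kiteP 1 (1 / 2) = 3 / 2 := by rw [kiteP, hr, hA, hW]; norm_num
  have hQ : kiteQ 1 (1 / 2) = 1 / 2 := by rw [kiteQ, hr, hA, hW]; norm_num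
  have hstar : ∀ i j, i ≠ j → rootArray i j 1 (1 / 2) = star j := by
    intro i j hij
    funext r t
    simp only [rootArray, kiteArray, hA, hB, hP, hQ, star]
    grind
  have hset : kiteSolutions 1 (-1) = Set.range star := by
    ext s
    constructor
    · intro hs
      obtain ⟨i, j, k, l, hn, -, -, z, hz, hs⟩ := exists_mem_axisSolutions one_ne_zero hs
      have hij := (nodup_four_iff.1 hn).1
      rw [hone, hone, div_one] at hz hs
      rw [kiteRoots_one, Set.mem_singleton_iff] at hz
      subst hz
      rcases hs with rfl | rfl
      · exact ⟨j, (hstar i j hij).symm⟩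
      · exact ⟨i, (hstar j i hij.symm).symm⟩
    · rintro ⟨j, rfl⟩
      obtain ⟨i, hij⟩ := exists_ne j
      obtain ⟨k, l, hn⟩ := exists_nodup_four hij
      refine mem_kiteSolutions_of_mem_axisSolutions one_ne_zero hn (by rw [hone, hone])
        (by rw [hone, hone]) ?_
      rw [hone, hone, div_one]
      exact ⟨1 / 2, by rw [kiteRoots_one]; rfl, Or.inl (hstar i j hij).symm⟩
  have hinj : Function.Injective star := by
    intro j j' h
    by_contra hne
    obtain ⟨k, l, hn⟩ := exists_nodup_four hne
    obtain ⟨-, h2, -, h4, -, -⟩ := nodup_four_iff.1 hn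
    have := congrFun (congrFun h j) k
    simp only [star, if_neg h2, true_or, if_true, h4.symm] at this
    norm_num at this
    exact hne this
  rw [hset, ← Set.image_univ, Set.ncard_image_of_injective _ hinj, Set.ncard_univ]
  simp

theorem kiteB_lt_of_pos {m z : ℝ} (hm : 0 < m) (hz : z ∈ kiteRoots m) :
    kiteB m z < 4 * kiteW z := by
  rcases lt_trichotomy m 1 with h | rfl | h
  · rw [kiteRoots_of_pos_of_lt_one hm h] at hz; exact hz.elim
  · rw [kiteRoots_one, Set.mem_singleton_iff] at hz
    subst hz; norm_num [kiteB, kiteW]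
  · exact (kiteRoots_of_one_lt h).2 z hz

theorem ncard_kiteSolutions_of_pos {m : ℝ} (hm : 0 < m) : (kiteSolutions m (-1)).ncard = 4 := by
  rcases lt_trichotomy m 1 with h | rfl | h
  · have h' : 1 < m⁻¹ := (one_lt_inv₀ hm).2 h
    obtain ⟨⟨z₁, z₂, hne, hz⟩, -⟩ := kiteRoots_of_one_lt h'
    rw [kiteSolutions_eq_union hm.ne' h.ne,
      axisSolutions_eq_empty (kiteRoots_of_pos_of_lt_one hm h), Set.empty_union]
    exact ncard_axisSolutions_of_pair (by decide) (inv_ne_zero hm.ne') hne hz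
  · exact kiteSolutions_one_ncard
  · obtain ⟨⟨z₁, z₂, hne, hz⟩, -⟩ := kiteRoots_of_one_lt h
    rw [kiteSolutions_eq_union hm.ne' h.ne', axisSolutions_eq_empty (i := 2) (j := 3)
      (kiteRoots_of_pos_of_lt_one (inv_pos.2 hm) (inv_lt_one_of_one_lt₀ h)), Set.union_empty]
    exact ncard_axisSolutions_of_pair (by decide) hm.ne' hne hz

theorem ncard_kiteSolutions_of_neg {m y z : ℝ} (hm : m < 0) (hy : kiteRoots m = {y})
    (hz : kiteRoots m⁻¹ = {z}) : (kiteSolutions m (-1)).ncard = 4 := by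
  have h1 := ncard_axisSolutions_of_singleton (show (0 : Fin 4) ≠ 1 by decide) hy
  have h2 := ncard_axisSolutions_of_singleton (show (2 : Fin 4) ≠ 3 by decide) hz
  rw [kiteSolutions_eq_union hm.ne (by linarith), Set.ncard_union_eq (disjoint_axisSolutions _ _)
    (Set.finite_of_ncard_pos (by omega)) (Set.finite_of_ncard_pos (by omega)), h1, h2]

theorem isConcaveConfig_of_mem_kiteSolutions {m : ℝ} (hm : 0 < m) {s : Fin 4 → Fin 4 → ℝ}
    (hs : s ∈ kiteSolutions m (-1)) {x : Fin 4 → EuclideanSpace ℝ (Fin 2)} (hx : Realizes x s) :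
    IsConcaveConfig x := by
  obtain ⟨i, j, k, l, hn, hkl, hij, hs⟩ := exists_mem_axisSolutions hm.ne' hs
  refine isConcaveConfig_of_mem_axisSolutions hn (fun z hz => kiteB_lt_of_pos ?_ hz) hs hx
  rcases vortexStrength_ratio hn hij hkl with ⟨h1, h2⟩ | ⟨h1, h2⟩ <;> rw [h1, h2] <;> positivity

theorem kiteSolutions_eq_empty {m lam : ℝ} (hm : -2 ≤ m) (hm' : m ≤ -1 / 2) (hlam : lam < 0) :
    kiteSolutions m lam = ∅ := by
  refine Set.eq_empty_of_forall_notMem ?_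
  rintro s ⟨hs, x, hx, ⟨i, j, hk⟩, hr⟩
  obtain ⟨-, k, l, hn, -⟩ := id hk
  obtain ⟨hkl, hij, z, hz, -⟩ :=
    scaled_mem_axisSolutions (by linarith) hlam hs hx hk hr hn
  -- The interval [-2, -1/2] is stable under inversion, so both possible ratios m and 1/m lie in it.
  have hempty : kiteRoots (vortexStrength m k / vortexStrength m i) = ∅ := by
    have hm0 : m < 0 := by linarith
    rcases vortexStrength_ratio hn hij hkl with ⟨h1, h2⟩ | ⟨h1, h2⟩ <;> rw [h1, h2]
    · rw [div_one]; exact kiteRoots_of_mem_Icc hm hm'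
    · refine kiteRoots_of_mem_Icc ?_ ?_
      · rw [le_div_iff_of_neg hm0]; linarith
      · rw [div_le_iff_of_neg hm0]; linarith
  rw [hempty] at hz
  exact hz.elim

theorem mainTheorem5 :
    (∀ m ∈ Set.Iio (-2 : ℝ) ∪ Set.Ioo (-1 / 2 : ℝ) 0 ∪ Set.Ioi (0 : ℝ),
      (kiteSolutions m (-1)).ncard = 4) ∧
    (∀ m ∈ Set.Ioi (0 : ℝ), ∀ s ∈ kiteSolutions m (-1), ∀ x, Realizes x s → IsConcaveConfig x) ∧
    (∀ m ∈ Set.Ioo (-1 / 2 : ℝ) 0,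
      (convexKiteSolutions m (-1) 2 3).ncard = 2 ∧
      (concaveKiteSolutions m (-1) 0 1).ncard = 2) ∧
    (∀ m ∈ Set.Iio (-2 : ℝ),
      (concaveKiteSolutions m (-1) 2 3).ncard = 2 ∧
      (convexKiteSolutions m (-1) 0 1).ncard = 2) ∧
    (∀ m : ℝ, m ≠ 0 →
      m ∉ Set.Iio (-2 : ℝ) ∪ Set.Ioo (-1 / 2 : ℝ) 0 ∪ Set.Ioi (0 : ℝ) →
      ∀ lam < 0, kiteSolutions m lam = ∅) := by
  -- Inversion exchanges (-1/2, 0) and (-∞, -2), so for negative m one axis carries the concave root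
  -- and the other the convex root.
  have hsmall : ∀ {m : ℝ}, -1 / 2 < m → m < 0 → m⁻¹ < -2 := fun {m} h h0 => by
    rw [← one_div, div_lt_iff_of_neg h0]; linarith
  have hlarge : ∀ {m : ℝ}, m < -2 → -1 / 2 < m⁻¹ ∧ m⁻¹ < 0 := fun {m} h => by
    have h0 : m < 0 := by linarith
    refine ⟨?_, inv_lt_zero.2 h0⟩
    rw [← one_div m, lt_div_iff_of_neg h0]; linarith
  refine ⟨?_, fun m hm s hs x hx => isConcaveConfig_of_mem_kiteSolutions hm hs hx, ?_, ?_, ?_⟩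
  · rintro m ((hm | ⟨hm, hm0⟩) | hm)
    · obtain ⟨y, hy, -⟩ := kiteRoots_of_lt_neg_two hm
      obtain ⟨z, hz, -⟩ := kiteRoots_of_mem_Ioo (hlarge hm).1 (hlarge hm).2
      exact ncard_kiteSolutions_of_neg (lt_trans hm (by norm_num)) hy hz
    · obtain ⟨y, hy, -⟩ := kiteRoots_of_mem_Ioo hm hm0
      obtain ⟨z, hz, -⟩ := kiteRoots_of_lt_neg_two (hsmall hm hm0)
      exact ncard_kiteSolutions_of_neg hm0 hy hz
    · exact ncard_kiteSolutions_of_pos hm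
  · rintro m ⟨hm, hm0⟩
    obtain ⟨y, hy, hy'⟩ := kiteRoots_of_mem_Ioo hm hm0
    obtain ⟨z, hz, hz'⟩ := kiteRoots_of_lt_neg_two (hsmall hm hm0)
    rw [convexKiteSolutions_eq (k := 0) (l := 1) hm0.ne (by decide) (by simp [vortexStrength])
        (by simp [vortexStrength]) (by simpa [vortexStrength, hz] using hz'),
      concaveKiteSolutions_eq (k := 2) (l := 3) hm0.ne (by decide) (by simp [vortexStrength])
        (by simp [vortexStrength]) (by simpa [vortexStrength, hy] using hy')]
    exact ⟨ncard_axisSolutions_of_singleton (by decide) (by simpa [vortexStrength] using hz),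
      ncard_axisSolutions_of_singleton (by decide) (by simpa [vortexStrength] using hy)⟩
  · intro m hm
    have hm0 : m < 0 := lt_trans hm (by norm_num)
    obtain ⟨y, hy, hy'⟩ := kiteRoots_of_lt_neg_two hm
    obtain ⟨z, hz, hz'⟩ := kiteRoots_of_mem_Ioo (hlarge hm).1 (hlarge hm).2
    rw [concaveKiteSolutions_eq (k := 0) (l := 1) hm0.ne (by decide) (by simp [vortexStrength])
        (by simp [vortexStrength]) (by simpa [vortexStrength, hz] using hz'),
      convexKiteSolutions_eq (k := 2) (l := 3) hm0.ne (by decide) (by simp [vortexStrength])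
        (by simp [vortexStrength]) (by simpa [vortexStrength, hy] using hy')]
    exact ⟨ncard_axisSolutions_of_singleton (by decide) (by simpa [vortexStrength] using hz),
      ncard_axisSolutions_of_singleton (by decide) (by simpa [vortexStrength] using hy)⟩
  · intro m hm0 hm lam hlam
    simp only [Set.mem_union, Set.mem_Iio, Set.mem_Ioo, Set.mem_Ioi, not_or, not_and,
      not_lt] at hm
    obtain ⟨⟨h1, h2⟩, h3⟩ := hm
    have hneg : m < 0 := lt_of_le_of_ne h3 hm0
    refine kiteSolutions_eq_empty h1 ?_ hlam
    by_contra h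
    exact absurd (h2 (not_le.1 h)) (not_le.2 hneg)
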